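/- **Setting.** For a permutation $\sigma$ of a finite set let $\sharp\sigma$ be its number of cycles (fixed points included), and let $S(E)$ be the group of permutations of a finite set $E$. For $N\in\mathbb N$ let $\Phi^N_E=\sum_{\sigma\in S(E)}N^{\sharp\sigma}\sigma\in\mathbb C[S(E)]$, and, when $\Phi^N_E$ is invertible, let $W^N_\sigma$ be the coefficient of $\sigma$ in $(\Phi^N_E)^{-1}$. Let $t\ge 0$, $s_1,\dots,s_t\ge 1$, and let $p^k_a\in\mathbb Z$, $\varepsilon^k_a\in\{1,-1\}$ ($1\le k\le t$, $1\le a\le s_k$) with $|p^k_a|\ge 3$. Let $$w_k=u^{p^k_1}v^{\varepsilon^k_1}u^{p^k_2}v^{\varepsilon^k_2}\cdots u^{p^k_{s_k}}v^{\varepsilon^k_{s_k}},\qquad W_k=U^{p^k_1}V^{\varepsilon^k_1}\cdots U^{p^k_{s_k}}V^{\varepsilon^k_{s_k}}\quad (U,V\in\mathcal U(N)).$$ Let $\widetilde U,\widetilde U^*,\widetilde V,\widetilde V^*$ be the sets of occurrences of the letters $u,u^{-1},v,v^{-1}$ in the words $w_1,w_1^{-1},\dots,w_t,w_t^{-1}$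 (each written out letter by letter), and $S$ their disjoint union. Let $\Psi:S\to S$ send each letter of $w_k$ to the corresponding inverse letter of $w_k^{-1}$ and conversely, and let $I(x)$ be the cyclic successor of $\Psi(x)$ in the word that contains $\Psi(x)$. For $\sigma_u\in S(\widetilde U)$, $\theta_u\in S(\widetilde U^*)$, $\sigma_v\in S(\widetilde V)$, $\theta_v\in S(\widetilde V^*)$ let $(\sigma_u,\theta_u,\sigma_v,\theta_v)$ be the permutation of $S$ that restricts to these four, and let $$R=R_N=\sum_{\sigma_u,\theta_u,\sigma_v,\theta_v}N^{\sharp(I\circ(\sigma_u,\theta_u,\sigma_v,\theta_v))}\;\sigma_u\otimes\theta_u\otimes\sigma_v\otimes\theta_v\in\mathbb C[S(\widetilde U)]\otimes\mathbb C[S(\widetilde U^*)]\otimes\mathbb C[S(\widetilde V)]\otimes\mathbb C[S(\widetilde V^*)].$$ When the coefficients $W^N$ are defined, let $\Phi$ be the linear functional on this space with $$\Phi(\sigma_1\otimes\theta_1\otimes\sigma_2\otimes\theta_2)=W^N_{\sigma_1\Psi^{-1}\theta_1\Psi}\,W^N_{\sigma_2\Psi^{-1}\theta_2\Psi}.$$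 Let $n=|\widetilde U|$ and $m=|\widetilde V|$ be the total numbers of $u$'s and of $v$'s. **Proposition.** 1. $n=\sum_{k,a}|p^k_a|$, $m=\sum_k s_k$, $m\le n$, and $I$ is an involution. 2. Let $X=\{1_x,\dots,(n-m)_x\}\cup\{1_y,\dots,m_y\}$, $\overline X=\{\overline 1_x,\dots,\overline{(n-m)}_x\}\cup\{\overline 1_y,\dots,\overline m_y\}$, $A=\{1_a,\dots,m_a\}$, $\overline A=\{\overline 1_a,\dots,\overline m_a\}$. There are bijections $\widetilde U\cong X$, $\widetilde U^*\cong\overline X$, $\widetilde V\cong A$, $\widetilde V^*\cong\overline A$, independent of $N$, under which $I$ becomes the following involution, again denoted $I$, of $X\sqcup\overline X\sqcup A\sqcup\overline A$: $i_x\leftrightarrow\overline i_x$ for $1\le i\le n-m$; and for each $1\le i\le m$ either ($i_y\leftrightarrow i_a$ and $\overline i_y\leftrightarrow\overline i_a$) or ($i_y\leftrightarrow\overline i_a$ and $\overline i_y\leftrightarrow i_a$), where the alternative may depend on $i$. Under the induced isomorphism of the tensor products of group algebras, for every $N$, $$R=\sum_{\sigma\in S(X),\ \overline\sigma\in S(\overline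 X),\ \theta\in S(A),\ \overline\theta\in S(\overline A)}N^{\sharp(I\circ(\sigma,\overline\sigma,\theta,\overline\theta))}\;\sigma\otimes\overline\sigma\otimes\theta\otimes\overline\theta .$$ 3. If $N>n$, then $\Phi^N_{\widetilde U}$ and $\Phi^N_{\widetilde V}$ are invertible, and, with respect to the Haar probability measure on $\mathcal U(N)$, $$\iint_{\mathcal U(N)^2}|\operatorname{Tr}(W_1)|^2\cdots|\operatorname{Tr}(W_t)|^2\,dU\,dV=\Phi(R).$$ -/

import Mathlib

open scoped TensorProduct BigOperators

noncomputable section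

namespace TraceWords

/-! ### Cycles, the elements `Φ^N` and the Weingarten coefficients -/

/-- The number of cycles of a permutation, fixed points included. -/
def numCycles {α : Type*} (σ : Equiv.Perm α) : ℕ :=
  Nat.card (Quotient (Equiv.Perm.SameCycle.setoid σ))

/-- The complex group algebra of the permutation group of `α`. -/
abbrev PermAlg (α : Type*) : Type _ := MonoidAlgebra ℂ (Equiv.Perm α)

/-- A permutation, as an element of the group algebra. -/
def perm {α : Type*} (σ : Equiv.Perm α) : PermAlg α := MonoidAlgebra.single σ 1

/-- `Φ^N = ∑ σ, N ^ (number of cycles of σ) • σ` in the group algebra of the permutations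
of the finite set `α`. -/
def cycleElement (α : Type*) [Fintype α] [DecidableEq α] (N : ℕ) : PermAlg α :=
  ∑ σ : Equiv.Perm α, ((N : ℂ) ^ numCycles σ) • perm σ

/-- `W^N_σ`: the coefficient of `σ` in the inverse of `Φ^N` (meaningful when `Φ^N` is a unit). -/
def weingarten {α : Type*} [Fintype α] [DecidableEq α] (N : ℕ) (σ : Equiv.Perm α) : ℂ :=
  (Ring.inverse (cycleElement α N)).coeff σ

/-- The linear functional on the group algebra with value `W^N_σ` at `σ`. -/
def weingartenLin (α : Type*) [Fintype α] [DecidableEq α] (N : ℕ) : PermAlg α →ₗ[ℂ] ℂ where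
  toFun x := ∑ σ : Equiv.Perm α, x.coeff σ * weingarten N σ
  map_add' x y := by simp [add_mul, Finset.sum_add_distrib]
  map_smul' c x := by simp [mul_assoc, Finset.mul_sum]

/-- The isomorphism of group algebras induced by a bijection of the underlying sets. -/
def relabel {α β : Type*} (e : α ≃ β) : PermAlg α ≃ₗ[ℂ] PermAlg β :=
  (MonoidAlgebra.domCongr ℂ ℂ e.permCongrHom).toLinearEquiv

/-! ### The symbols of `∏ₖ |Tr wₖ|²`

A letter is a pair `(g, s)` : `g = false` is the generator `u`, `g = true` is the generator `v`,
and `s = true` means the generator itself, `s = false` its inverse (adjoint).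
A family of words is a function `w` into lists of letters. -/

section Symbols

variable {t : ℕ} (w : Fin t → List (Bool × Bool))

/-- The set of occurrences of letters in `∏ₖ Tr wₖ · Tr wₖ⁻¹`: the symbol `(k, false, j)` is the
`j`-th letter of `wₖ`, and `(k, true, j)` is the `j`-th letter of `wₖ⁻¹`. -/
abbrev Sym : Type := Σ k : Fin t, Bool × Fin (w k).length

/-- The letter at a symbol; the `j`-th letter of `wₖ⁻¹` is the inverse of the letter
of `wₖ` in position `j` counted from the end. -/
def letter : Sym w → Bool × Bool
  | ⟨k, false, j⟩ => (w k).get j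
  | ⟨k, true, j⟩ => (((w k).get j.rev).1, !((w k).get j.rev).2)

/-- The symbols carrying a given letter. -/
abbrev SymOf (l : Bool × Bool) : Type := {x : Sym w // letter w x = l}

/-- The occurrences of `U`. -/
abbrev SymU : Type := SymOf w (false, true)
/-- The occurrences of `U*`. -/
abbrev SymUs : Type := SymOf w (false, false)
/-- The occurrences of `V`. -/
abbrev SymV : Type := SymOf w (true, true)
/-- The occurrences of `V*`. -/
abbrev SymVs : Type := SymOf w (true, false)

/-- The cyclic successor of a symbol in its word. -/
def succSym : Equiv.Perm (Sym w) :=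
  Equiv.sigmaCongrRight fun k => Equiv.prodCongr (Equiv.refl Bool) (finRotate (w k).length)

/-- `Ψ`: sends a symbol of `wₖ` to the corresponding starred symbol of `wₖ⁻¹`, and conversely. -/
def Psi : Equiv.Perm (Sym w) :=
  Equiv.sigmaCongrRight fun _ => Equiv.prodCongr Equiv.boolNot Fin.revPerm

/-- `I`: sends a symbol `x` to the cyclic successor of `Ψ x`. -/
def invI : Equiv.Perm (Sym w) := (Psi w).trans (succSym w)

lemma letter_Psi (x : Sym w) :
    letter w (Psi w x) = ((letter w x).1, !(letter w x).2) := by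
  rcases x with ⟨k, b, j⟩
  cases b <;> simp [letter, Psi]

lemma letter_Psi_iff (g : Bool) (x : Sym w) :
    letter w x = (g, false) ↔ letter w (Psi w x) = (g, true) := by
  rw [letter_Psi]
  rcases letter w x with ⟨a, b⟩
  cases b <;> simp

/-- `Ψ` as a bijection from the occurrences of `U*` (resp. `V*`) to those of `U` (resp. `V`). -/
def PsiRes (g : Bool) : SymOf w (g, false) ≃ SymOf w (g, true) :=
  (Psi w).subtypeEquiv (letter_Psi_iff w g)

/-- The concatenation `(σᵤ, θᵤ, σᵥ, θᵥ)` of permutations of the four sets of occurrences, as a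
permutation of all symbols (`ofSubtype` extends a permutation by the identity). -/
def concat (σu : Equiv.Perm (SymU w)) (θu : Equiv.Perm (SymUs w))
    (σv : Equiv.Perm (SymV w)) (θv : Equiv.Perm (SymVs w)) : Equiv.Perm (Sym w) :=
  Equiv.Perm.ofSubtype σu * Equiv.Perm.ofSubtype θu *
    (Equiv.Perm.ofSubtype σv * Equiv.Perm.ofSubtype θv)

/-- The space `ℂ(S_U) ⊗ ℂ(S_U*) ⊗ ℂ(S_V) ⊗ ℂ(S_V*)`. -/
abbrev WordTensor : Type :=
  (PermAlg (SymU w) ⊗[ℂ] PermAlg (SymUs w)) ⊗[ℂ] (PermAlg (SymV w) ⊗[ℂ] PermAlg (SymVs w))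

/-- The element `R = ∑ N ^ ♯(I ∘ (σᵤ, θᵤ, σᵥ, θᵥ)) • σᵤ ⊗ θᵤ ⊗ σᵥ ⊗ θᵥ`. -/
def elementR (N : ℕ) : WordTensor w :=
  ∑ σu : Equiv.Perm (SymU w), ∑ θu : Equiv.Perm (SymUs w),
    ∑ σv : Equiv.Perm (SymV w), ∑ θv : Equiv.Perm (SymVs w),
      ((N : ℂ) ^ numCycles (invI w * concat w σu θu σv θv)) •
        ((perm σu ⊗ₜ[ℂ] perm θu) ⊗ₜ[ℂ] (perm σv ⊗ₜ[ℂ] perm θv))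

/-- The linear functional `σ ⊗ θ ↦ W^N_{σ Ψ⁻¹ θ Ψ}` for the generator `g`. -/
def pairingLin (g : Bool) (N : ℕ) :
    PermAlg (SymOf w (g, true)) ⊗[ℂ] PermAlg (SymOf w (g, false)) →ₗ[ℂ] ℂ :=
  weingartenLin (SymOf w (g, true)) N ∘ₗ
    LinearMap.mul' ℂ (PermAlg (SymOf w (g, true))) ∘ₗ
      TensorProduct.map LinearMap.id (relabel (PsiRes w g)).toLinearMap

/-- The linear functional
`Φ : σ₁ ⊗ θ₁ ⊗ σ₂ ⊗ θ₂ ↦ W^N_{σ₁ Ψ⁻¹ θ₁ Ψ} * W^N_{σ₂ Ψ⁻¹ θ₂ Ψ}`. -/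
def functionalPhi (N : ℕ) : WordTensor w →ₗ[ℂ] ℂ :=
  LinearMap.mul' ℂ ℂ ∘ₗ TensorProduct.map (pairingLin w false N) (pairingLin w true N)

/-- The value of `Φ` on elementary tensors of permutations. -/
lemma functionalPhi_tmul (N : ℕ) (σ₁ : Equiv.Perm (SymU w)) (θ₁ : Equiv.Perm (SymUs w))
    (σ₂ : Equiv.Perm (SymV w)) (θ₂ : Equiv.Perm (SymVs w)) :
    functionalPhi w N ((perm σ₁ ⊗ₜ[ℂ] perm θ₁) ⊗ₜ[ℂ] (perm σ₂ ⊗ₜ[ℂ] perm θ₂)) =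
      weingarten N (σ₁ * (PsiRes w false).permCongr θ₁) *
        weingarten N (σ₂ * (PsiRes w true).permCongr θ₂) := by
  simp [functionalPhi, pairingLin, relabel, perm, weingartenLin, MonoidAlgebra.single_mul_single,
    MonoidAlgebra.domCongr_single, MonoidAlgebra.coeff_single, Finsupp.single_apply,
    Equiv.permCongrHom]

end Symbols

/-! ### The words `U^{p₁} V^{ε₁} ⋯ U^{pₛ} V^{εₛ}` -/

/-- The word `u^{p₁} v^{ε₁} ⋯ u^{pₛ} v^{εₛ}`, spelled out letter by letter. -/
def alternatingWord {s : ℕ} (p ε : Fin s → ℤ) : List (Bool × Bool) :=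
  (List.ofFn fun a =>
    List.replicate (p a).natAbs (false, decide (0 < p a)) ++
      List.replicate (ε a).natAbs (true, decide (0 < ε a))).flatten

/-- `U^{p₁} V^{ε₁} ⋯ U^{pₛ} V^{εₛ}` for unitary matrices `U`, `V`. -/
def evalWord {N s : ℕ} (p ε : Fin s → ℤ) (U V : Matrix.unitaryGroup (Fin N) ℂ) :
    Matrix.unitaryGroup (Fin N) ℂ :=
  (List.ofFn fun a => U ^ p a * V ^ ε a).prod

/-! ### The model: labels, and the map `I` on labels -/

/-- `X = X₀ ∪ Y` with `X₀ = {1_x, …, (n-m)_x}` and `Y = {1_y, …, m_y}`; the same type with bars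
serves as `X̄ = X̄₀ ∪ Ȳ`. -/
abbrev XSet (n m : ℕ) : Type := Fin (n - m) ⊕ Fin m

/-- The disjoint union `(X ⊔ X̄) ⊔ (A ⊔ Ā)`. -/
abbrev Labels (n m : ℕ) : Type := (XSet n m ⊕ XSet n m) ⊕ (Fin m ⊕ Fin m)

section Model

variable {n m : ℕ}

/-- `i_x` -/
abbrev xL (i : Fin (n - m)) : Labels n m := Sum.inl (Sum.inl (Sum.inl i))
/-- `i_y` -/
abbrev yL (i : Fin m) : Labels n m := Sum.inl (Sum.inl (Sum.inr i))
/-- `ī_x` -/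
abbrev xbarL (i : Fin (n - m)) : Labels n m := Sum.inl (Sum.inr (Sum.inl i))
/-- `ī_y` -/
abbrev ybarL (i : Fin m) : Labels n m := Sum.inl (Sum.inr (Sum.inr i))
/-- `i_a` -/
abbrev aL (i : Fin m) : Labels n m := Sum.inr (Sum.inl i)
/-- `ī_a` -/
abbrev abarL (i : Fin m) : Labels n m := Sum.inr (Sum.inr i)

/-- The map `I` on labels: `i_x ↔ ī_x`; if `τ i = true` then `i_y ↔ i_a` and `ī_y ↔ ī_a`;
if `τ i = false` then `i_y ↔ ī_a` and `ī_y ↔ i_a`. -/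
def modelFun (τ : Fin m → Bool) : Labels n m → Labels n m
  | Sum.inl (Sum.inl (Sum.inl i)) => xbarL i
  | Sum.inl (Sum.inr (Sum.inl i)) => xL i
  | Sum.inl (Sum.inl (Sum.inr i)) => if τ i then aL i else abarL i
  | Sum.inl (Sum.inr (Sum.inr i)) => if τ i then abarL i else aL i
  | Sum.inr (Sum.inl i) => if τ i then yL i else ybarL i
  | Sum.inr (Sum.inr i) => if τ i then ybarL i else yL i

lemma modelFun_involutive (τ : Fin m → Bool) :
    Function.Involutive (modelFun τ : Labels n m → Labels n m) := by
  rintro (((i | i) | (i | i)) | (i | i)) <;> simp only [modelFun]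
  all_goals cases h : τ i <;> simp [h]

/-- The map `I` on labels, as a permutation. -/
def modelI (τ : Fin m → Bool) : Equiv.Perm (Labels n m) := (modelFun_involutive τ).toPerm

/-- The space `ℂ(S(X)) ⊗ ℂ(S(X̄)) ⊗ ℂ(S(A)) ⊗ ℂ(S(Ā))`. -/
abbrev ModelTensor (n m : ℕ) : Type :=
  (PermAlg (XSet n m) ⊗[ℂ] PermAlg (XSet n m)) ⊗[ℂ] (PermAlg (Fin m) ⊗[ℂ] PermAlg (Fin m))

/-- `∑ N ^ ♯(I ∘ (σ, σ̄, θ, θ̄)) • σ ⊗ σ̄ ⊗ θ ⊗ θ̄` for the explicit map `I` on labels. -/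
def modelR (τ : Fin m → Bool) (N : ℕ) : ModelTensor n m :=
  ∑ σ : Equiv.Perm (XSet n m), ∑ σ' : Equiv.Perm (XSet n m),
    ∑ θ : Equiv.Perm (Fin m), ∑ θ' : Equiv.Perm (Fin m),
      ((N : ℂ) ^ numCycles (modelI τ *
          Equiv.sumCongr (Equiv.sumCongr σ σ') (Equiv.sumCongr θ θ'))) •
        ((perm σ ⊗ₜ[ℂ] perm σ') ⊗ₜ[ℂ] (perm θ ⊗ₜ[ℂ] perm θ'))

variable {t : ℕ} {w : Fin t → List (Bool × Bool)}

/-- The symbol with a given label, for given identifications of the four sets of occurrences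
`U`, `U*`, `V`, `V*` with `X`, `X̄`, `A`, `Ā`. -/
def symbolOf (eU : SymU w ≃ XSet n m) (eU' : SymUs w ≃ XSet n m)
    (eV : SymV w ≃ Fin m) (eV' : SymVs w ≃ Fin m) : Labels n m → Sym w :=
  Sum.elim (Sum.elim (fun x => (eU.symm x).1) (fun x => (eU'.symm x).1))
    (Sum.elim (fun x => (eV.symm x).1) (fun x => (eV'.symm x).1))

/-- The isomorphism of tensor products induced by the four identifications. -/
def relabelTensor (eU : SymU w ≃ XSet n m) (eU' : SymUs w ≃ XSet n m)
    (eV : SymV w ≃ Fin m) (eV' : SymVs w ≃ Fin m) : WordTensor w ≃ₗ[ℂ] ModelTensor n m :=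
  TensorProduct.congr (TensorProduct.congr (relabel eU) (relabel eU'))
    (TensorProduct.congr (relabel eV) (relabel eV'))

end Model

/-! ### Haar measure on the unitary group -/

instance (N : ℕ) : MeasurableSpace (Matrix.unitaryGroup (Fin N) ℂ) := borel _

instance (N : ℕ) : BorelSpace (Matrix.unitaryGroup (Fin N) ℂ) := ⟨rfl⟩

instance (N : ℕ) : CompactSpace (Matrix.unitaryGroup (Fin N) ℂ) := by
  have hK : IsCompact {A : Matrix (Fin N) (Fin N) ℂ | ∀ i, A i ∈ {r : Fin N → ℂ |
      ∀ j, r j ∈ Metric.closedBall (0 : ℂ) 1}} :=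
    isCompact_pi_infinite fun _ => isCompact_pi_infinite fun _ => isCompact_closedBall 0 1
  have hc : IsClosed (Matrix.unitaryGroup (Fin N) ℂ : Set (Matrix (Fin N) (Fin N) ℂ)) := by
    have : (Matrix.unitaryGroup (Fin N) ℂ : Set (Matrix (Fin N) (Fin N) ℂ)) =
        {A | A * star A = 1} := by
      ext A
      exact Matrix.mem_unitaryGroup_iff
    rw [this]
    exact isClosed_eq (by fun_prop) continuous_const
  refine isCompact_iff_compactSpace.mp (hK.of_isClosed_subset hc ?_)
  intro A hA i j
  simpa using entry_norm_bound_of_unitary hA i j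

/-- The Haar probability measure on `U(N)`. -/
def haarU (N : ℕ) : MeasureTheory.Measure (Matrix.unitaryGroup (Fin N) ℂ) :=
  MeasureTheory.Measure.haarMeasure ⊤

end TraceWords

end

/-! Writing |Tr W|² as Tr W · Tr W⁻¹ turns the integrand into a sum over index functions i on all
symbols of the product of the entries at (i x, i (succ x)). An entry at an inverse letter is the
conjugate of the transposed entry, so for fixed i the integral splits into one Haar moment in U and
one in V. The Weingarten formula `haarMoment_eq` expands each moment over pairs of permutations,
with Kronecker deltas. As I is Ψ followed by the successor, all the deltas take the form i x = i (I
(σ x)). Together they say that i is constant on the cycles of I ∘ (σᵤ, θᵤ, σᵥ, θᵥ), and summing over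
i gives N to the number of cycles, hence Φ(R).

For the Weingarten formula, fix the column indices. By left invariance the moment, as a matrix in
the row indices, commutes with V^{⊗α} for every unitary V, hence by Zariski density with X^{⊗α} for
every matrix X. When N ≥ |α| this makes it a combination ∑ c σ of permutation operators
(`exists_eq_permKernel`). Contracting the row indices, by orthonormality of the columns of U,
computes Φ^N * c, and Φ^N is invertible because it is a Gram matrix of linearly independent
permutation operators.

For the shape of I, cyclically adjacent letters of w_k with the same generator are equal powers of
u. So I sends no v-type letter to a v-type letter, and sends a u-type letter to a u-type letter only
if it is the inverse one. Counting symbols by the letters at x and I x then gives the model. -/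

noncomputable section

namespace TraceWords

/-! ### Counting functions that are constant on cycles -/

/-- Functions that are invariant under a permutation are functions on its set of cycles. -/
def invariantFunEquiv {α β : Type*} (ρ : Equiv.Perm α) :
    {f : α → β // ∀ x, f (ρ x) = f x} ≃
      (Quotient (Equiv.Perm.SameCycle.setoid ρ) → β) where
  toFun f := Quotient.lift f.1 (by
    rintro a b ⟨k, rfl⟩
    induction k with
    | zero => simp
    | succ k ih => rw [ih, add_comm, zpow_add, zpow_one, Equiv.Perm.mul_apply, f.2]
    | pred k ih =>
      have hk : ρ * ρ ^ (-(k : ℤ) - 1) = ρ ^ (-(k : ℤ)) := by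
        rw [← zpow_one_add]
        congr 1
        ring
      rw [ih, ← f.2 ((ρ ^ (-(k : ℤ) - 1)) a), ← Equiv.Perm.mul_apply, hk])
  invFun g := ⟨fun x => g (Quotient.mk _ x), fun x => congrArg g (Quotient.sound
    (show ρ.SameCycle (ρ x) x from Equiv.Perm.sameCycle_apply_left.mpr (.refl _ _)))⟩
  left_inv f := rfl
  right_inv g := by
    funext q
    induction q using Quotient.inductionOn
    rfl

lemma card_invariant {α : Type*} [Fintype α] [DecidableEq α] (N : ℕ) (ρ : Equiv.Perm α) :
    (Finset.univ.filter fun f : α → Fin N => ∀ x, f (ρ x) = f x).card = N ^ numCycles ρ := by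
  classical
  rw [← Fintype.card_subtype, Fintype.card_congr (invariantFunEquiv ρ), Fintype.card_fun,
    Fintype.card_fin, numCycles, Nat.card_eq_fintype_card]

lemma sum_invariant {α : Type*} [Fintype α] [DecidableEq α] (N : ℕ) (ρ : Equiv.Perm α) :
    (∑ f : α → Fin N, if ∀ x, f (ρ x) = f x then (1 : ℂ) else 0) = (N : ℂ) ^ numCycles ρ := by
  rw [Finset.sum_boole, card_invariant, Nat.cast_pow]

/-! ### Convolution in the group algebra -/

section Convolution

variable {α : Type*} [Fintype α] [DecidableEq α]

/-- The element of the group algebra with given coefficients. -/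
def ofCoeffs (c : Equiv.Perm α → ℂ) : PermAlg α := ∑ σ, c σ • perm σ

lemma coeff_ofCoeffs (c : Equiv.Perm α → ℂ) (σ : Equiv.Perm α) : (ofCoeffs c).coeff σ = c σ := by
  simp [ofCoeffs, perm, MonoidAlgebra.coeff_sum, MonoidAlgebra.coeff_single,
    Finsupp.single_apply]

lemma ofCoeffs_coeff (x : PermAlg α) : ofCoeffs (fun σ => x.coeff σ) = x :=
  MonoidAlgebra.ext (Finsupp.ext fun σ => coeff_ofCoeffs _ σ)

lemma ofCoeffs_injective : Function.Injective (ofCoeffs : (Equiv.Perm α → ℂ) → PermAlg α) := by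
  intro c d h
  funext σ
  rw [← coeff_ofCoeffs c, h, coeff_ofCoeffs]

lemma ofCoeffs_mul (c d : Equiv.Perm α → ℂ) :
    ofCoeffs c * ofCoeffs d = ofCoeffs fun τ => ∑ σ, c (τ * σ⁻¹) * d σ := by
  have h : ∀ σ τ : Equiv.Perm α, perm σ * perm τ = perm (σ * τ) := by
    simp [perm, MonoidAlgebra.single_mul_single]
  simp only [ofCoeffs, Finset.sum_mul, Finset.mul_sum, smul_mul_smul_comm, h, Finset.sum_smul]
  conv_rhs => rw [Finset.sum_comm]
  refine Finset.sum_congr rfl fun σ _ => ?_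
  exact Fintype.sum_equiv (Equiv.mulRight σ) _ _ fun τ => by simp

lemma cycleElement_eq (N : ℕ) : cycleElement α N = ofCoeffs fun σ => (N : ℂ) ^ numCycles σ := rfl

/-- The operator on tensors indexed by functions attached to an element of the group algebra,
entrywise. -/
def permKernel {N : ℕ} (c : Equiv.Perm α → ℂ) (i i' : α → Fin N) : ℂ :=
  ∑ σ, c σ * if i = i' ∘ σ then 1 else 0

/-- Distinct permutations rearrange an injective index function differently, so its column displays
every coefficient: permutation operators are independent as soon as such an ι exists. -/
lemma permKernel_embedding {N : ℕ} (ι : α ↪ Fin N) (c : Equiv.Perm α → ℂ) (σ : Equiv.Perm α) :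
    permKernel c (ι ∘ σ) ι = c σ := by
  have : ∀ τ : Equiv.Perm α, ((ι : α → Fin N) ∘ σ = ι ∘ τ) ↔ τ = σ := by
    intro τ
    rw [ι.injective.comp_left.eq_iff, DFunLike.coe_fn_eq, eq_comm]
  simp [permKernel, this]

lemma sum_comp_eq_comp (N : ℕ) (σ τ : Equiv.Perm α) :
    (∑ i' : α → Fin N, if i' ∘ τ = i' ∘ σ then (1 : ℂ) else 0) =
      (N : ℂ) ^ numCycles (τ * σ⁻¹) := by
  rw [← sum_invariant]
  refine Finset.sum_congr rfl fun f _ => ?_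
  congr 1
  rw [funext_iff, eq_iff_iff, ← σ.forall_congr_right (q := fun x => f ((τ * σ⁻¹) x) = f x)]
  simp

/-- By `ofCoeffs_mul`, the right side is the coefficient at τ of Φ^N * c, so contraction against
permutations is multiplication by Φ^N. -/
lemma sum_comp_permKernel (N : ℕ) (c : Equiv.Perm α → ℂ) (τ : Equiv.Perm α) :
    (∑ i' : α → Fin N, permKernel c (i' ∘ τ) i') =
      ∑ σ, (N : ℂ) ^ numCycles (τ * σ⁻¹) * c σ := by
  simp only [permKernel]
  rw [Finset.sum_comm]
  refine Finset.sum_congr rfl fun σ _ => ?_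
  rw [← Finset.mul_sum, sum_comp_eq_comp, mul_comm]

/-- The squared Hilbert–Schmidt norm of the operator attached to c is the Hermitian form ⟨c, Φ^N *
c⟩. -/
lemma sum_permKernel_mul_star (N : ℕ) (c : Equiv.Perm α → ℂ) :
    (∑ i : α → Fin N, ∑ i' : α → Fin N, permKernel c i i' * star (permKernel c i i')) =
      ∑ τ, star (c τ) * ∑ σ, (N : ℂ) ^ numCycles (τ * σ⁻¹) * c σ := by
  simp only [← sum_comp_permKernel, Finset.mul_sum]
  have : ∀ i i' : α → Fin N, permKernel c i i' * star (permKernel c i i') =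
      ∑ τ : Equiv.Perm α, if i = i' ∘ τ then star (c τ) * permKernel c i i' else 0 := by
    intro i i'
    conv_lhs => rw [mul_comm]; enter [1]; rw [permKernel]
    rw [star_sum, Finset.sum_mul]
    refine Finset.sum_congr rfl fun τ _ => ?_
    split_ifs <;> simp
  simp only [this]
  rw [Finset.sum_comm]
  conv_rhs => rw [Finset.sum_comm]
  refine Finset.sum_congr rfl fun i' _ => ?_
  rw [Finset.sum_comm]
  refine Finset.sum_congr rfl fun τ _ => ?_
  simp

/-- If Φ^N * x = 0, the Hilbert–Schmidt norm of the operator of x vanishes, so all its entries do,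
and an injective column shows x = 0. -/
lemma isUnit_cycleElement (N : ℕ) (h : Fintype.card α ≤ N) : IsUnit (cycleElement α N) := by
  obtain ⟨ι⟩ : Nonempty (α ↪ Fin N) :=
    Function.Embedding.nonempty_of_card_le (by simpa using h)
  have hinj : Function.Injective (LinearMap.mulLeft ℂ (cycleElement α N)) := by
    rw [← LinearMap.ker_eq_bot, LinearMap.ker_eq_bot']
    intro x hx
    rw [LinearMap.mulLeft_apply, ← ofCoeffs_coeff x, cycleElement_eq, ofCoeffs_mul] at hx
    have hx' := ofCoeffs_injective (hx.trans (show (0 : PermAlg α) = ofCoeffs 0 by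
      simp [ofCoeffs]))
    have h0 := sum_permKernel_mul_star N fun σ => x.coeff σ
    rw [Finset.sum_eq_zero (s := Finset.univ) (f := fun τ => star (x.coeff τ) * _)
      fun τ _ => by rw [congrFun hx' τ]; simp] at h0
    have h1 : ∑ i : α → Fin N, ∑ i' : α → Fin N,
        Complex.normSq (permKernel (fun σ => x.coeff σ) i i') = 0 := by
      have : ∀ z : ℂ, z * star z = (Complex.normSq z : ℂ) := Complex.mul_conj
      simp only [this] at h0
      exact_mod_cast h0
    refine MonoidAlgebra.ext (Finsupp.ext fun σ => ?_)
    rw [Finset.sum_eq_zero_iff_of_nonneg fun i _ =>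
      Finset.sum_nonneg fun i' _ => Complex.normSq_nonneg _] at h1
    have h2 := h1 (ι ∘ σ) (Finset.mem_univ _)
    rw [Finset.sum_eq_zero_iff_of_nonneg fun i' _ => Complex.normSq_nonneg _] at h2
    have h3 := h2 ι (Finset.mem_univ _)
    rw [permKernel_embedding, Complex.normSq_eq_zero] at h3
    exact h3
  -- In finite dimension, injective left multiplication is onto, and a one-sided inverse is
  -- two-sided.
  obtain ⟨y, hy⟩ := LinearMap.injective_iff_surjective.mp hinj 1
  have hy' : cycleElement α N * y = 1 := hy
  refine IsUnit.of_mul_eq_one y hy'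

lemma eq_weingarten_convolution (N : ℕ) (h : Fintype.card α ≤ N) (c d : Equiv.Perm α → ℂ)
    (hcd : ∀ τ, ∑ σ, (N : ℂ) ^ numCycles (τ * σ⁻¹) * c σ = d τ) (σ : Equiv.Perm α) :
    c σ = ∑ τ, weingarten N (σ * τ⁻¹) * d τ := by
  have h1 : cycleElement α N * ofCoeffs c = ofCoeffs d := by
    rw [cycleElement_eq, ofCoeffs_mul]
    exact congrArg ofCoeffs (funext hcd)
  have h2 : ofCoeffs c = Ring.inverse (cycleElement α N) * ofCoeffs d := by
    rw [← h1, Ring.inverse_mul_cancel_left _ _ (isUnit_cycleElement N h)]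
  rw [← ofCoeffs_coeff (Ring.inverse (cycleElement α N)), ofCoeffs_mul] at h2
  exact congrFun (ofCoeffs_injective h2) σ

end Convolution

/-! ### Polynomials that vanish on the unitary group -/

section Density

variable {N : ℕ} (q : MvPolynomial (Fin N × Fin N) ℂ)

/-- For fixed U this is a polynomial in d. It vanishes on the torus |d_a| = 1, where the matrix is
unitary, and a product of infinite sets determines a polynomial. -/
lemma eval_conj_diagonal_eq_zero
    (h : ∀ U ∈ Matrix.unitaryGroup (Fin N) ℂ, q.eval (fun e => U e.1 e.2) = 0)
    (U : Matrix.unitaryGroup (Fin N) ℂ) (d : Fin N → ℂ) :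
    q.eval (fun e => (U.1 * Matrix.diagonal d * star U.1) e.1 e.2) = 0 := by
  set q' : MvPolynomial (Fin N) ℂ := MvPolynomial.bind₁ (fun e : Fin N × Fin N =>
    ∑ a, MvPolynomial.C (U.1 e.1 a) * MvPolynomial.X a * MvPolynomial.C ((star U.1) a e.2)) q
    with hq'
  have key : ∀ d : Fin N → ℂ, q'.eval d =
      q.eval (fun e => (U.1 * Matrix.diagonal d * star U.1) e.1 e.2) := by
    intro d
    rw [hq', ← MvPolynomial.coe_aeval_eq_eval, RingHom.coe_coe, MvPolynomial.aeval_bind₁,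
      ← MvPolynomial.coe_aeval_eq_eval, RingHom.coe_coe]
    congr 2
    funext e
    rw [Matrix.mul_apply]
    simp [Matrix.mul_diagonal]
  have hzero : q' = 0 := by
    refine MvPolynomial.funext_set (fun _ => Metric.sphere (0 : ℂ) 1) (fun _ => ?_) fun x hx => ?_
    · have : Infinite (Set.Ioc (-Real.pi) Real.pi) :=
        (Set.Ioc_infinite (by linarith [Real.pi_pos])).to_subtype
      have : Infinite Circle := Circle.argEquiv.infinite_iff.mpr this
      exact (Set.infinite_range_of_injective (f := fun z : Circle => (z : ℂ))
        Circle.coe_injective).mono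
        (by rintro _ ⟨z, rfl⟩; exact mem_sphere_zero_iff_norm.mpr z.norm_coe)
    · rw [key, map_zero]
      refine h _ (mul_mem (mul_mem U.2 ?_) (Unitary.star_mem U.2))
      rw [Matrix.mem_unitaryGroup_iff, Matrix.star_eq_conjTranspose, Matrix.diagonal_conjTranspose,
        Matrix.diagonal_mul_diagonal, ← Matrix.diagonal_one]
      congr 1
      funext a
      have ha := hx a (Set.mem_univ a)
      rw [mem_sphere_zero_iff_norm] at ha
      have h2 : x a * star (x a) = ((‖x a‖ : ℂ)) ^ 2 := Complex.mul_conj' _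
      simpa [ha] using h2
  rw [← key, hzero, map_zero]

lemma eval_isHermitian_eq_zero
    (h : ∀ U ∈ Matrix.unitaryGroup (Fin N) ℂ, q.eval (fun e => U e.1 e.2) = 0)
    {A : Matrix (Fin N) (Fin N) ℂ} (hA : A.IsHermitian) : q.eval (fun e => A e.1 e.2) = 0 := by
  have h1 := eval_conj_diagonal_eq_zero q h hA.eigenvectorUnitary (RCLike.ofReal ∘ hA.eigenvalues)
  have h2 := hA.spectral_theorem
  rw [Unitary.conjStarAlgAut_apply] at h2
  rwa [← h2] at h1

/-- The unitary group is Zariski dense in the space of all matrices. -/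
lemma eval_eq_zero_of_unitaryGroup
    (h : ∀ U ∈ Matrix.unitaryGroup (Fin N) ℂ, q.eval (fun e => U e.1 e.2) = 0)
    (X : Matrix (Fin N) (Fin N) ℂ) : q.eval (fun e => X e.1 e.2) = 0 := by
  set A := (realPart X : Matrix (Fin N) (Fin N) ℂ) with hA
  set B := (imaginaryPart X : Matrix (Fin N) (Fin N) ℂ) with hB
  have hX : X = A + Complex.I • B := (realPart_add_I_smul_imaginaryPart X).symm
  -- Restrict q to the complex line A + zB: real z gives Hermitian matrices, so infinitely many
  -- roots, and z = i gives X.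
  set f : Polynomial ℂ := MvPolynomial.aeval (fun e : Fin N × Fin N =>
    Polynomial.C (A e.1 e.2) + Polynomial.X * Polynomial.C (B e.1 e.2)) q with hf
  have key : ∀ z : ℂ, f.eval z = q.eval (fun e => (A + z • B) e.1 e.2) := by
    intro z
    rw [hf, ← Polynomial.coe_evalRingHom, ← RingHom.coe_coe (MvPolynomial.aeval _),
      ← RingHom.comp_apply]
    have : ((Polynomial.evalRingHom z).comp (MvPolynomial.aeval (fun e : Fin N × Fin N =>
        Polynomial.C (A e.1 e.2) + Polynomial.X * Polynomial.C (B e.1 e.2)) :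
        MvPolynomial (Fin N × Fin N) ℂ →ₐ[ℂ] Polynomial ℂ).toRingHom) =
        MvPolynomial.eval (fun e : Fin N × Fin N => (A + z • B) e.1 e.2) := by
      ext e
      · simp
      · simp [mul_comm z]
    exact congrArg (fun g : MvPolynomial (Fin N × Fin N) ℂ →+* ℂ => g q) this
  have hzero : f = 0 := by
    refine Polynomial.eq_zero_of_infinite_isRoot f ?_
    refine (Set.infinite_range_of_injective Complex.ofReal_injective).mono ?_
    rintro _ ⟨r, rfl⟩
    rw [Set.mem_ofPred_eq, Polynomial.IsRoot.def, key]
    refine eval_isHermitian_eq_zero q h ?_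
    have hA' : star A = A := (realPart X).2
    have hB' : star B = B := (imaginaryPart X).2
    rw [Matrix.IsHermitian, ← Matrix.star_eq_conjTranspose, star_add, star_smul, hA', hB']
    simp
  rw [hX, ← key, hzero, Polynomial.eval_zero]

end Density

/-! ### The commutant of the tensor powers of the unitary group -/

lemma prod_indicator {α : Type*} [Fintype α] (P : α → Prop) [DecidablePred P] :
    (∏ x, if P x then (1 : ℂ) else 0) = if ∀ x, P x then 1 else 0 := by
  simp [Finset.prod_ite_zero]

section Commutant

variable {α : Type*} [Fintype α] [DecidableEq α] {N : ℕ}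

lemma commute_of_commute_unitary (T : (α → Fin N) → (α → Fin N) → ℂ)
    (hT : ∀ U ∈ Matrix.unitaryGroup (Fin N) ℂ, ∀ i l : α → Fin N,
      ∑ k, T i k * ∏ x, U (k x) (l x) = ∑ k, (∏ x, U (i x) (k x)) * T k l)
    (X : Matrix (Fin N) (Fin N) ℂ) (i l : α → Fin N) :
    ∑ k, T i k * ∏ x, X (k x) (l x) = ∑ k, (∏ x, X (i x) (k x)) * T k l := by
  have key := eval_eq_zero_of_unitaryGroup
    (∑ k : α → Fin N, MvPolynomial.C (T i k) * ∏ x, MvPolynomial.X (k x, l x) -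
      ∑ k : α → Fin N, (∏ x, MvPolynomial.X (i x, k x)) * MvPolynomial.C (T k l))
    (fun U hU => by
      have hU' := hT U hU i l
      simpa [MvPolynomial.eval_sum, MvPolynomial.eval_prod, sub_eq_zero] using hU') X
  simpa [MvPolynomial.eval_sum, MvPolynomial.eval_prod, sub_eq_zero] using key

/-- In dimension at least the degree, an operator on tensors that commutes with the tensor
powers of all unitary matrices is a combination of permutation operators. -/
lemma exists_eq_permKernel (h : Fintype.card α ≤ N) (T : (α → Fin N) → (α → Fin N) → ℂ)
    (hT : ∀ U ∈ Matrix.unitaryGroup (Fin N) ℂ, ∀ i l : α → Fin N,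
      ∑ k, T i k * ∏ x, U (k x) (l x) = ∑ k, (∏ x, U (i x) (k x)) * T k l) :
    ∃ c : Equiv.Perm α → ℂ, T = permKernel c := by
  obtain ⟨ι⟩ : Nonempty (α ↪ Fin N) :=
    Function.Embedding.nonempty_of_card_le (by simpa using h)
  have hX := commute_of_commute_unitary T hT
  -- A k that is not a rearrangement of ι misses some value ι x₀. The diagonal projection killing
  -- that coordinate annihilates e_ι and fixes e_k, so commutation gives T k ι = 0.
  have hker : ∀ k : α → Fin N, (¬ ∃ σ : Equiv.Perm α, k = ι ∘ σ) → T k ι = 0 := by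
    intro k hk
    obtain ⟨x₀, hx₀⟩ : ∃ x₀, ∀ y, k y ≠ ι x₀ := by
      by_contra! hcon
      choose g hg using hcon
      have hginj : Function.Injective g := fun a b hab =>
        ι.injective (by rw [← hg a, ← hg b, hab])
      have hgbij := Finite.injective_iff_bijective.mp hginj
      refine hk ⟨(Equiv.ofBijective g hgbij).symm, funext fun y => ?_⟩
      obtain ⟨a, rfl⟩ := hgbij.2 y
      rw [hg, Function.comp_apply, Equiv.ofBijective_symm_apply_apply]
    have h1 := hX (Matrix.diagonal fun a => if a = ι x₀ then 0 else 1) k ι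
    have hl : ∀ k' : α → Fin N, (∏ x, (Matrix.diagonal
        (fun a => if a = ι x₀ then (0 : ℂ) else 1)) (k' x) (ι x)) = 0 := by
      intro k'
      refine Finset.prod_eq_zero (Finset.mem_univ x₀) ?_
      by_cases hkx : k' x₀ = ι x₀ <;> simp [hkx]
    have hr : ∀ k' : α → Fin N, (∏ x, (Matrix.diagonal
        (fun a => if a = ι x₀ then (0 : ℂ) else 1)) (k x) (k' x)) =
        if k = k' then 1 else 0 := by
      intro k'
      simp only [Matrix.diagonal_apply, hx₀, if_false]
      rw [prod_indicator]
      simp only [funext_iff]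
    simp only [hl, hr] at h1
    simpa using h1.symm
  refine ⟨fun σ => T (ι ∘ σ) ι, ?_⟩
  funext i l
  classical
  -- This matrix maps e_{ι x} to e_{l x}, so its tensor power maps e_ι to e_l, and column ι of T
  -- determines column l.
  have h1 := hX (fun a b => if ∃ x, b = ι x ∧ a = l x then 1 else 0) i ι
  have hentry : ∀ (a : Fin N) (x : α), (∃ y, ι x = ι y ∧ a = l y) ↔ a = l x := by
    intro a x
    constructor
    · rintro ⟨y, hy, rfl⟩
      rw [ι.injective hy]
    · exact fun h => ⟨x, rfl, h⟩
  have hl : ∀ k : α → Fin N,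
      (∏ x, if ∃ y, ι x = ι y ∧ k x = l y then (1 : ℂ) else 0) = if k = l then 1 else 0 := by
    intro k
    rw [prod_indicator]
    simp only [hentry, funext_iff]
  simp only [hl, mul_ite, mul_one, mul_zero, Finset.sum_ite_eq', Finset.mem_univ, if_true] at h1
  rw [h1, permKernel]
  have hinj : Function.Injective fun σ : Equiv.Perm α => (ι ∘ σ : α → Fin N) := fun σ τ hστ =>
    DFunLike.coe_injective (ι.injective.comp_left hστ)
  rw [← Finset.sum_subset (Finset.subset_univ (Finset.univ.image
    fun σ : Equiv.Perm α => (ι ∘ σ : α → Fin N))), Finset.sum_image hinj.injOn]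
  · refine Finset.sum_congr rfl fun σ _ => ?_
    rw [mul_comm, prod_indicator]
    congr 2
    rw [eq_iff_iff, funext_iff]
    exact forall_congr' fun x => hentry _ _
  · intro k _ hk
    rw [hker k fun ⟨σ, hσ⟩ => hk (Finset.mem_image.mpr ⟨σ, Finset.mem_univ _, hσ.symm⟩), mul_zero]

end Commutant

/-! ### Moments of the Haar measure -/

section Haar

instance (N : ℕ) : MeasureTheory.IsProbabilityMeasure (haarU N) :=
  ⟨MeasureTheory.Measure.haarMeasure_self⟩

instance (N : ℕ) : (haarU N).IsMulLeftInvariant := by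
  unfold haarU
  infer_instance

lemma integrable_haarU {N : ℕ} {f : Matrix.unitaryGroup (Fin N) ℂ → ℂ} (hf : Continuous f) :
    MeasureTheory.Integrable f (haarU N) :=
  hf.integrable_of_hasCompactSupport (HasCompactSupport.of_compactSpace f)

@[fun_prop]
lemma continuous_prod_entries {α : Type*} [Fintype α] {N : ℕ} (i j : α → Fin N) :
    Continuous fun U : Matrix.unitaryGroup (Fin N) ℂ => ∏ x, U.1 (i x) (j x) :=
  continuous_finsetProd _ fun x _ => continuous_subtype_val.matrix_elem (i x) (j x)

variable {α : Type*} [Fintype α] [DecidableEq α] {N : ℕ}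

/-- The integral of a product of matrix entries and of conjugates of matrix entries. -/
def haarMoment (i j i' j' : α → Fin N) : ℂ :=
  ∫ U, (∏ x, U.1 (i x) (j x)) * star (∏ x, U.1 (i' x) (j' x)) ∂haarU N

lemma integrable_moment {α : Type*} [Fintype α] {N : ℕ} (i j i' j' : α → Fin N) :
    MeasureTheory.Integrable (fun U : Matrix.unitaryGroup (Fin N) ℂ =>
      (∏ x, U.1 (i x) (j x)) * star (∏ x, U.1 (i' x) (j' x))) (haarU N) :=
  integrable_haarU (by fun_prop)

lemma prod_mul_entries (A B : Matrix (Fin N) (Fin N) ℂ) (i j : α → Fin N) :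
    ∏ x, (A * B) (i x) (j x) = ∑ k : α → Fin N, (∏ x, A (i x) (k x)) * ∏ x, B (k x) (j x) := by
  simp only [Matrix.mul_apply, Fintype.prod_sum, Finset.prod_mul_distrib]

/-- Replace U by VU in the integral; on the conjugated factor the sum over k is then undone by V*V =
1. -/
lemma haarMoment_commute (j j' : α → Fin N) (V : Matrix (Fin N) (Fin N) ℂ)
    (hV : V ∈ Matrix.unitaryGroup (Fin N) ℂ) (i l : α → Fin N) :
    ∑ k, haarMoment i j k j' * ∏ x, V (k x) (l x) =
      ∑ k, (∏ x, V (i x) (k x)) * haarMoment k j l j' := by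
  have hleft : ∀ k, haarMoment i j k j' = ∫ U, (∏ x, (V * U.1) (i x) (j x)) *
      star (∏ x, (V * U.1) (k x) (j' x)) ∂haarU N := fun k =>
    (MeasureTheory.integral_mul_left_eq_self (μ := haarU N)
      (fun U => (∏ x, U.1 (i x) (j x)) * star (∏ x, U.1 (k x) (j' x))) ⟨V, hV⟩).symm
  have hstar : ∀ U : Matrix.unitaryGroup (Fin N) ℂ,
      ∑ k : α → Fin N, star (∏ x, (V * U.1) (k x) (j' x)) * ∏ x, V (k x) (l x) =
        star (∏ x, U.1 (l x) (j' x)) := by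
    intro U
    have h1 : U.1 = star V * (V * U.1) := by
      rw [← mul_assoc, Matrix.mem_unitaryGroup_iff'.mp hV, one_mul]
    conv_rhs => rw [h1, prod_mul_entries]
    rw [star_sum]
    refine Finset.sum_congr rfl fun k _ => ?_
    rw [star_mul, star_prod Finset.univ fun x => (star V) (l x) (k x)]
    simp [Matrix.star_apply]
  have hint : ∀ k : α → Fin N, MeasureTheory.Integrable (fun U : Matrix.unitaryGroup (Fin N) ℂ =>
      (∏ x, (V * U.1) (i x) (j x)) * star (∏ x, (V * U.1) (k x) (j' x)) * ∏ x, V (k x) (l x))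
      (haarU N) := by
    intro k
    refine (integrable_haarU ?_).mul_const _
    simp only [prod_mul_entries]
    fun_prop
  simp only [hleft, ← MeasureTheory.integral_mul_const]
  rw [← MeasureTheory.integral_finsetSum _ fun k _ => hint k]
  simp only [haarMoment, ← MeasureTheory.integral_const_mul]
  rw [← MeasureTheory.integral_finsetSum _ fun k _ => (integrable_moment k j l j').const_mul _]
  congr 1
  funext U
  simp only [mul_assoc]
  rw [← Finset.mul_sum, hstar, prod_mul_entries, Finset.sum_mul]
  simp only [mul_assoc]

/-- The integrand is constant: summing over row indices pairs columns of U, which are orthonormal.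
-/
lemma sum_haarMoment_comp (j j' : α → Fin N) (τ : Equiv.Perm α) :
    ∑ i' : α → Fin N, haarMoment (i' ∘ τ) j i' j' = if j = j' ∘ τ then 1 else 0 := by
  simp only [haarMoment]
  rw [← MeasureTheory.integral_finsetSum _ fun k _ => integrable_moment _ j _ j']
  have : ∀ U : Matrix.unitaryGroup (Fin N) ℂ, ∑ i' : α → Fin N,
      (∏ x, U.1 ((i' ∘ τ) x) (j x)) * star (∏ x, U.1 (i' x) (j' x)) =
        if j = j' ∘ τ then 1 else 0 := by
    intro U
    have h1 : ∀ i' : α → Fin N, (∏ x, U.1 ((i' ∘ τ) x) (j x)) =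
        ∏ x, U.1 (i' x) (j (τ.symm x)) := fun i' =>
      Fintype.prod_equiv τ _ _ fun x => by simp
    have h2 : ∀ a b, ∑ c, U.1 c a * star (U.1 c b) = if b = a then 1 else 0 := by
      intro a b
      have := congrFun (congrFun (Matrix.mem_unitaryGroup_iff'.mp U.2) b) a
      rw [Matrix.mul_apply, Matrix.one_apply] at this
      rw [← this]
      exact Finset.sum_congr rfl fun c _ => by rw [Matrix.star_apply, mul_comm]
    simp only [h1, star_prod, ← Finset.prod_mul_distrib]
    rw [← Fintype.prod_sum fun x c => U.1 c (j (τ.symm x)) * star (U.1 c (j' x))]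
    simp only [h2]
    rw [prod_indicator]
    congr 1
    rw [eq_iff_iff, funext_iff, ← τ.forall_congr_right]
    simp [eq_comm]
  simp only [this]
  simp

/-- The Weingarten formula for the moments of a Haar unitary matrix. -/
theorem haarMoment_eq (h : Fintype.card α ≤ N) (i j i' j' : α → Fin N) :
    haarMoment i j i' j' = ∑ σ : Equiv.Perm α, ∑ τ : Equiv.Perm α,
      (if i = i' ∘ σ then 1 else 0) * (if j = j' ∘ τ then 1 else 0) * weingarten N (σ * τ⁻¹) := by
  obtain ⟨c, hc⟩ := exists_eq_permKernel h (fun i i' => haarMoment i j i' j')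
    fun V hV => haarMoment_commute j j' V hV
  have hc' : ∀ i i', haarMoment i j i' j' = permKernel c i i' := fun i i' =>
    congrFun (congrFun hc i) i'
  have hd : ∀ τ : Equiv.Perm α, ∑ σ, (N : ℂ) ^ numCycles (τ * σ⁻¹) * c σ =
      if j = j' ∘ τ then 1 else 0 := by
    intro τ
    rw [← sum_comp_permKernel, ← sum_haarMoment_comp j j' τ]
    simp only [hc']
  rw [hc', permKernel]
  refine Finset.sum_congr rfl fun σ _ => ?_
  rw [eq_weingarten_convolution N h c _ hd σ, Finset.sum_mul]
  exact Finset.sum_congr rfl fun τ _ => by ring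

end Haar

/-! ### Traces of products -/

/-- A sum over paths from a to b with l interior points: `Fin.cons a i` lists where the steps start
and `Fin.snoc i b` where they end. -/
lemma prod_ofFn_apply {N l : ℕ} (f : Fin (l + 1) → Matrix (Fin N) (Fin N) ℂ) (a b : Fin N) :
    (List.ofFn f).prod a b = ∑ i : Fin l → Fin N,
      ∏ j, f j (Fin.cons (α := fun _ => Fin N) a i j) (Fin.snoc (α := fun _ => Fin N) i b j) := by
  induction l generalizing a with
  | zero => simp [Fin.snoc]
  | succ l ih =>
    rw [List.ofFn_succ, List.prod_cons, Matrix.mul_apply,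
      ← (Fin.consEquiv fun _ : Fin (l + 1) => Fin N).sum_comp, Fintype.sum_prod_type]
    refine Finset.sum_congr rfl fun c _ => ?_
    rw [ih, Finset.mul_sum]
    refine Finset.sum_congr rfl fun i _ => ?_
    rw [Fin.prod_univ_succ (n := l + 1)]
    simp [Fin.consEquiv, ← Fin.cons_snoc_eq_snoc_cons]

/-- Closing the path makes the successor cyclic. For l = 0 the left side is N and the right side 1.
-/
lemma trace_prod_ofFn {N l : ℕ} (hl : l ≠ 0) (f : Fin l → Matrix (Fin N) (Fin N) ℂ) :
    (List.ofFn f).prod.trace = ∑ g : Fin l → Fin N, ∏ j, f j (g j) (g (finRotate l j)) := by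
  obtain ⟨l, rfl⟩ := Nat.exists_eq_succ_of_ne_zero hl
  rw [← (Fin.consEquiv fun _ : Fin (l + 1) => Fin N).sum_comp, Fintype.sum_prod_type,
    Matrix.trace]
  refine Finset.sum_congr rfl fun a _ => ?_
  rw [Matrix.diag_apply, prod_ofFn_apply]
  refine Finset.sum_congr rfl fun i _ => Finset.prod_congr rfl fun j _ => ?_
  rw [Fin.snoc_eq_cons_rotate]
  rfl

lemma finRotate_rev_finRotate {l : ℕ} (j : Fin l) :
    finRotate l (finRotate l j).rev = j.rev := by
  cases l with
  | zero => exact j.elim0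
  | succ l =>
    induction j using Fin.lastCases with
    | last => simp
    | cast j =>
      rw [finRotate_apply, finRotate_apply, Fin.coeSucc_eq_succ, Fin.rev_succ,
        Fin.coeSucc_eq_succ, Fin.rev_castSucc]

/-- The unitary matrix at a letter. -/
def letterEval {N : ℕ} (U V : Matrix.unitaryGroup (Fin N) ℂ) (l : Bool × Bool) :
    Matrix.unitaryGroup (Fin N) ℂ :=
  if l.2 then (if l.1 then V else U) else (if l.1 then V else U)⁻¹

lemma letterEval_inv {N : ℕ} (U V : Matrix.unitaryGroup (Fin N) ℂ) (l : Bool × Bool) :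
    letterEval U V (l.1, !l.2) = (letterEval U V l)⁻¹ := by
  rcases l with ⟨a, b⟩
  cases b <;> simp [letterEval]

lemma letterEval_pow_natAbs {N : ℕ} (U V : Matrix.unitaryGroup (Fin N) ℂ) (g : Bool) (p : ℤ) :
    letterEval U V (g, decide (0 < p)) ^ p.natAbs = (if g then V else U) ^ p := by
  rcases lt_or_ge 0 p with h | h
  · lift p to ℕ using h.le
    simp only [letterEval, h, decide_true, if_true, Int.natAbs_natCast, zpow_natCast]
  · obtain ⟨k, rfl⟩ := Int.exists_eq_neg_ofNat h
    simp only [letterEval, not_lt.mpr h, decide_false, Bool.false_eq_true, if_false,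
      Int.natAbs_neg, Int.natAbs_natCast, zpow_neg, zpow_natCast, inv_pow]

lemma evalWord_eq {N s : ℕ} (p ε : Fin s → ℤ) (U V : Matrix.unitaryGroup (Fin N) ℂ) :
    evalWord p ε U V = ((alternatingWord p ε).map (letterEval U V)).prod := by
  rw [evalWord, alternatingWord, List.map_flatten, List.prod_flatten, List.map_ofFn,
    List.map_ofFn]
  congr 2
  funext a
  simp [letterEval_pow_natAbs]

section Symbols

variable {t : ℕ} (w : Fin t → List (Bool × Bool)) {N : ℕ}

lemma trace_word {l : List (Bool × Bool)} (hl : l ≠ []) (U V : Matrix.unitaryGroup (Fin N) ℂ) :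
    ((l.map (letterEval U V)).prod).1.trace = ∑ g : Fin l.length → Fin N,
      ∏ j, (letterEval U V (l.get j)).1 (g j) (g (finRotate l.length j)) := by
  rw [← trace_prod_ofFn (by simpa using hl) fun j => (letterEval U V (l.get j)).1]
  congr 1
  have : List.ofFn (fun j => (letterEval U V (l.get j)).1) =
      (l.map (letterEval U V)).map (Submonoid.subtype _) := by
    conv_rhs => rw [← List.ofFn_get l, List.map_ofFn, List.map_ofFn]
    rfl
  rw [this, ← map_list_prod]
  rfl

lemma star_trace_word {l : List (Bool × Bool)} (hl : l ≠ [])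
    (U V : Matrix.unitaryGroup (Fin N) ℂ) :
    star ((l.map (letterEval U V)).prod).1.trace = ∑ g : Fin l.length → Fin N,
      ∏ j : Fin l.length, (letterEval U V ((l.get j.rev).1, !(l.get j.rev).2)).1 (g j)
        (g (finRotate l.length j)) := by
  rw [trace_word hl, star_sum,
    -- Conjugation swaps the row and column indices of each factor, so the index at position j is
    -- renamed to the one at the successor of `j.rev`.
    ← ((Fin.revPerm.trans (finRotate l.length)).arrowCongr (Equiv.refl (Fin N))).symm.sum_comp]
  refine Finset.sum_congr rfl fun g _ => ?_
  rw [star_prod, ← Equiv.prod_comp Fin.revPerm]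
  refine Finset.prod_congr rfl fun j _ => ?_
  rw [letterEval_inv]
  change star ((letterEval U V (l.get j.rev)).1 (g (finRotate _ j.rev.rev))
      (g (finRotate _ (finRotate _ j.rev).rev))) =
    star ((letterEval U V (l.get j.rev)).1 (g (finRotate _ j)) (g j))
  rw [finRotate_rev_finRotate, Fin.rev_rev]

/-- Functions on symbols are families of functions on the positions of the words. -/
def symFunEquiv (β : Type*) :
    (Sym w → β) ≃ ((q : Fin t × Bool) → Fin (w q.1).length → β) where
  toFun i q j := i ⟨q.1, q.2, j⟩
  invFun G x := G (x.1, x.2.1) x.2.2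
  left_inv _ := rfl
  right_inv _ := rfl

lemma prod_norm_trace_sq (hw : ∀ k, w k ≠ []) (U V : Matrix.unitaryGroup (Fin N) ℂ) :
    (∏ k, ((‖Matrix.trace (((w k).map (letterEval U V)).prod).1‖ : ℂ)) ^ 2) =
      ∑ i : Sym w → Fin N, ∏ x, (letterEval U V (letter w x)).1 (i x) (i (succSym w x)) := by
  have h1 : ∀ k, ((‖Matrix.trace (((w k).map (letterEval U V)).prod).1‖ : ℂ)) ^ 2 =
      ∏ b : Bool, ∑ g : Fin (w k).length → Fin N,
        ∏ j, (letterEval U V (letter w ⟨k, b, j⟩)).1 (g j) (g (finRotate _ j)) := by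
    intro k
    rw [← Complex.mul_conj', Fintype.prod_bool, mul_comm]
    congr 1
    · exact star_trace_word (hw k) U V
    · exact trace_word (hw k) U V
  simp only [h1]
  rw [← Fintype.prod_prod_type' (f := fun k b => ∑ g : Fin (w k).length → Fin N,
        ∏ j, (letterEval U V (letter w ⟨k, b, j⟩)).1 (g j) (g (finRotate _ j))),
    Fintype.prod_sum fun (q : Fin t × Bool) (g : Fin (w q.1).length → Fin N) =>
      ∏ j, (letterEval U V (letter w ⟨q.1, q.2, j⟩)).1 (g j) (g (finRotate _ j)),
    ← (symFunEquiv w (Fin N)).sum_comp]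
  refine Finset.sum_congr rfl fun i _ => ?_
  rw [Fintype.prod_sigma, Fintype.prod_prod_type]
  refine Finset.prod_congr rfl fun k _ => ?_
  rw [Fintype.prod_prod_type]
  rfl

lemma prod_by_letter {M : Type*} [CommMonoid M] (f : Sym w → M) :
    ∏ x, f x = ((∏ x : SymU w, f x) * ∏ x : SymUs w, f x) *
      ((∏ x : SymV w, f x) * ∏ x : SymVs w, f x) := by
  rw [← (Equiv.sigmaFiberEquiv (letter w)).prod_comp, Fintype.prod_sigma, Fintype.prod_prod_type,
    Fintype.prod_bool, Fintype.prod_bool, Fintype.prod_bool, mul_comm]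
  rfl

lemma forall_by_letter (P : Sym w → Prop) :
    (∀ x, P x) ↔ ((∀ x : SymU w, P x) ∧ ∀ x : SymUs w, P x) ∧
      ((∀ x : SymV w, P x) ∧ ∀ x : SymVs w, P x) := by
  refine ⟨fun h => ⟨⟨fun x => h x, fun x => h x⟩, fun x => h x, fun x => h x⟩,
    fun h x => ?_⟩
  rcases hx : letter w x with ⟨_ | _, _ | _⟩
  · exact h.1.2 ⟨x, hx⟩
  · exact h.1.1 ⟨x, hx⟩
  · exact h.2.2 ⟨x, hx⟩
  · exact h.2.1 ⟨x, hx⟩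

/-! ### The integral as a sum over permutations -/

lemma Psi_involutive : Function.Involutive (Psi w) := by
  rintro ⟨k, b, j⟩
  simp [Psi]

lemma invI_involutive : Function.Involutive (invI w) := by
  rintro ⟨k, b, j⟩
  simp [invI, Psi, succSym, -finRotate_apply, finRotate_rev_finRotate]

/-- The integral over one of the generators of the entries at its occurrences. -/
def symbolMoment (g : Bool) (i : Sym w → Fin N) : ℂ :=
  haarMoment (fun x : SymOf w (g, true) => i x) (fun x => i (succSym w x))
    (fun x => i (succSym w ((PsiRes w g).symm x))) (fun x => i ((PsiRes w g).symm x))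

lemma symbolMoment_eq (g : Bool) (h : Fintype.card (SymOf w (g, true)) ≤ N) (i : Sym w → Fin N) :
    symbolMoment w g i = ∑ σ : Equiv.Perm (SymOf w (g, true)),
      ∑ θ : Equiv.Perm (SymOf w (g, false)),
        (if ∀ x : SymOf w (g, true), i x = i (invI w (σ x)) then 1 else 0) *
        (if ∀ x : SymOf w (g, false), i x = i (invI w (θ x)) then 1 else 0) *
        weingarten N (σ * (PsiRes w g).permCongr θ) := by
  have hPsi : ∀ x, ((PsiRes w g).symm x : Sym w) = Psi w x := fun x =>
    (Psi_involutive w).symm_eq_self_of_involutive ▸ rfl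
  rw [symbolMoment, haarMoment_eq h]
  refine Finset.sum_congr rfl fun σ _ => ?_
  -- Substitute τ = (ΨθΨ⁻¹)⁻¹. The column condition i (succ y) = i (Ψ (τ y)), taken at y = Ψ (θ x),
  -- becomes i (I (θ x)) = i x.
  rw [← ((PsiRes w g).permCongr.trans (Equiv.inv _)).sum_comp]
  refine Finset.sum_congr rfl fun θ _ => ?_
  rw [Equiv.trans_apply, Equiv.inv_apply, inv_inv]
  congr 3
  · rw [eq_iff_iff, funext_iff]
    refine forall_congr' fun x => ?_
    rw [Function.comp_apply, hPsi]
    rfl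
  · rw [eq_iff_iff, funext_iff, ← ((PsiRes w g).permCongr θ).forall_congr_right,
      ← (PsiRes w g).forall_congr_right]
    refine forall_congr' fun x => ?_
    have hx : ((PsiRes w g).permCongr θ)⁻¹ (PsiRes w g (θ x)) = PsiRes w g x := by
      rw [Equiv.Perm.inv_eq_iff_eq]
      simp
    simp only [Function.comp_apply, Equiv.permCongr_apply, Equiv.symm_apply_apply] at hx ⊢
    rw [hx, Equiv.symm_apply_apply, eq_comm]
    rfl

lemma prod_letterEval (i : Sym w → Fin N) (U V : Matrix.unitaryGroup (Fin N) ℂ) :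
    ∏ x, (letterEval U V (letter w x)).1 (i x) (i (succSym w x)) =
      ((∏ x : SymU w, U.1 (i x) (i (succSym w x))) *
        star (∏ x : SymU w, U.1 (i (succSym w ((PsiRes w false).symm x)))
          (i ((PsiRes w false).symm x)))) *
      ((∏ x : SymV w, V.1 (i x) (i (succSym w x))) *
        star (∏ x : SymV w, V.1 (i (succSym w ((PsiRes w true).symm x)))
          (i ((PsiRes w true).symm x)))) := by
  rw [prod_by_letter]
  congr 2
  · exact Finset.prod_congr rfl fun x _ => by rw [x.2]; rfl
  · rw [star_prod, ← (PsiRes w false).prod_comp]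
    refine Finset.prod_congr rfl fun x _ => ?_
    rw [x.2, Equiv.symm_apply_apply]
    rfl
  · exact Finset.prod_congr rfl fun x _ => by rw [x.2]; rfl
  · rw [star_prod, ← (PsiRes w true).prod_comp]
    refine Finset.prod_congr rfl fun x _ => ?_
    rw [x.2, Equiv.symm_apply_apply]
    rfl

/-- For each i the integrand is a function of U times a function of V, so no exchange of integrals
is needed. -/
lemma integral_prod_norm_trace_sq (hw : ∀ k, w k ≠ []) :
    ((∫ U, ∫ V, ∏ k, ‖Matrix.trace (((w k).map (letterEval U V)).prod).1‖ ^ 2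
      ∂haarU N ∂haarU N : ℝ) : ℂ) =
      ∑ i : Sym w → Fin N, symbolMoment w false i * symbolMoment w true i := by
  rw [← integral_complex_ofReal]
  simp only [← integral_complex_ofReal, Complex.ofReal_prod, Complex.ofReal_pow,
    prod_norm_trace_sq w hw, prod_letterEval]
  have h1 : ∀ (U : Matrix.unitaryGroup (Fin N) ℂ), _ := fun U =>
    MeasureTheory.integral_finsetSum (μ := haarU N) Finset.univ fun (i : Sym w → Fin N) _ =>
      (integrable_moment (fun x : SymV w => i x) (fun x => i (succSym w x))
        (fun x => i (succSym w ((PsiRes w true).symm x)))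
        (fun x => i ((PsiRes w true).symm x))).const_mul
        ((∏ x : SymU w, U.1 (i x) (i (succSym w x))) *
        star (∏ x : SymU w, U.1 (i (succSym w ((PsiRes w false).symm x)))
          (i ((PsiRes w false).symm x))))
  simp only [h1, MeasureTheory.integral_const_mul]
  rw [MeasureTheory.integral_finsetSum _ fun (i : Sym w → Fin N) _ =>
      (integrable_moment (fun x : SymU w => i x) (fun x => i (succSym w x))
        (fun x => i (succSym w ((PsiRes w false).symm x)))
        (fun x => i ((PsiRes w false).symm x))).mul_const _]
  simp only [MeasureTheory.integral_mul_const]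
  rfl

lemma concat_apply (σu : Equiv.Perm (SymU w)) (θu : Equiv.Perm (SymUs w))
    (σv : Equiv.Perm (SymV w)) (θv : Equiv.Perm (SymVs w)) :
    ((∀ x : SymU w, concat w σu θu σv θv x = σu x) ∧
      ∀ x : SymUs w, concat w σu θu σv θv x = θu x) ∧
    (∀ x : SymV w, concat w σu θu σv θv x = σv x) ∧
      ∀ x : SymVs w, concat w σu θu σv θv x = θv x := by
  have hne : ∀ {l l' : Bool × Bool} (σ : Equiv.Perm (SymOf w l')) (x : SymOf w l), l ≠ l' →
      Equiv.Perm.ofSubtype σ (x : Sym w) = x := fun σ x h =>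
    Equiv.Perm.ofSubtype_apply_of_not_mem σ fun h' => h (x.2.symm.trans h')
  refine ⟨⟨fun x => ?_, fun x => ?_⟩, fun x => ?_, fun x => ?_⟩
  all_goals simp [concat, hne, Equiv.Perm.ofSubtype_apply_coe]

/-- The power counts the i invariant under the permutation, and invariance is checked separately on
the four kinds of letters. -/
lemma pow_numCycles_invI (σu : Equiv.Perm (SymU w)) (θu : Equiv.Perm (SymUs w))
    (σv : Equiv.Perm (SymV w)) (θv : Equiv.Perm (SymVs w)) :
    (N : ℂ) ^ numCycles (invI w * concat w σu θu σv θv) = ∑ i : Sym w → Fin N,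
      ((if ∀ x : SymU w, i x = i (invI w (σu x)) then 1 else 0) *
        (if ∀ x : SymUs w, i x = i (invI w (θu x)) then 1 else 0)) *
      ((if ∀ x : SymV w, i x = i (invI w (σv x)) then 1 else 0) *
        (if ∀ x : SymVs w, i x = i (invI w (θv x)) then 1 else 0)) := by
  rw [← sum_invariant]
  refine Finset.sum_congr rfl fun i _ => ?_
  simp only [ite_zero_mul_ite_zero, mul_one]
  congr 1
  obtain ⟨⟨h1, h2⟩, h3, h4⟩ := concat_apply w σu θu σv θv
  rw [eq_iff_iff, forall_by_letter]
  simp only [Equiv.Perm.mul_apply, h1, h2, h3, h4, eq_comm]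

lemma functionalPhi_elementR (hu : Fintype.card (SymU w) ≤ N) (hv : Fintype.card (SymV w) ≤ N) :
    functionalPhi w N (elementR w N) =
      ∑ i : Sym w → Fin N, symbolMoment w false i * symbolMoment w true i := by
  have h : ∀ i : Sym w → Fin N, symbolMoment w false i * symbolMoment w true i =
      ∑ σu : Equiv.Perm (SymU w), ∑ θu : Equiv.Perm (SymUs w),
      ∑ σv : Equiv.Perm (SymV w), ∑ θv : Equiv.Perm (SymVs w),
      ((if ∀ x : SymU w, i x = i (invI w (σu x)) then 1 else 0) *
        (if ∀ x : SymUs w, i x = i (invI w (θu x)) then 1 else 0)) *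
      ((if ∀ x : SymV w, i x = i (invI w (σv x)) then 1 else 0) *
        (if ∀ x : SymVs w, i x = i (invI w (θv x)) then 1 else 0)) *
      (weingarten N (σu * (PsiRes w false).permCongr θu) *
        weingarten N (σv * (PsiRes w true).permCongr θv)) := by
    intro i
    rw [symbolMoment_eq w false hu, symbolMoment_eq w true hv, Finset.sum_mul]
    refine Finset.sum_congr rfl fun σu _ => ?_
    rw [Finset.sum_mul]
    refine Finset.sum_congr rfl fun θu _ => ?_
    rw [Finset.mul_sum]
    refine Finset.sum_congr rfl fun σv _ => ?_
    rw [Finset.mul_sum]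
    exact Finset.sum_congr rfl fun θv _ => by ring
  simp only [h, elementR, map_sum, map_smul, functionalPhi_tmul, pow_numCycles_invI, smul_eq_mul,
    Finset.sum_mul]
  conv_rhs => rw [Finset.sum_comm]
  refine Finset.sum_congr rfl fun σu _ => ?_
  conv_rhs => rw [Finset.sum_comm]
  refine Finset.sum_congr rfl fun θu _ => ?_
  conv_rhs => rw [Finset.sum_comm]
  refine Finset.sum_congr rfl fun σv _ => ?_
  conv_rhs => rw [Finset.sum_comm]

end Symbols

/-! ### Counting the letters -/

/-- A letter of w_k and its partner in w_k⁻¹ contribute one occurrence of a generator and one of its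
inverse, whence the independence of s. -/
lemma card_symOf {t : ℕ} (w : Fin t → List (Bool × Bool)) (g s : Bool) :
    Fintype.card (SymOf w (g, s)) =
      ∑ k, ((w k).map fun a => if a.1 = g then 1 else 0).sum := by
  rw [Fintype.card_subtype, Finset.card_filter, Fintype.sum_sigma]
  refine Finset.sum_congr rfl fun k _ => ?_
  rw [Fintype.sum_prod_type, Fintype.sum_bool, ← Equiv.sum_comp Fin.revPerm,
    ← Finset.sum_add_distrib, ← Fin.sum_univ_fun_getElem]
  refine Finset.sum_congr rfl fun j _ => ?_
  simp only [letter, Fin.revPerm_apply, Fin.rev_rev, List.get_eq_getElem]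
  change _ = if (w k)[(j : ℕ)].1 = g then 1 else 0
  obtain ⟨⟨a, b⟩, hx⟩ : ∃ x, (w k)[(j : ℕ)] = x := ⟨_, rfl⟩
  simp only [hx]
  cases a <;> cases b <;> cases g <;> cases s <;> simp

lemma sum_map_alternatingWord {s : ℕ} (p ε : Fin s → ℤ) (g : Bool) :
    ((alternatingWord p ε).map fun a => if a.1 = g then 1 else 0).sum =
      ∑ a, if g then (ε a).natAbs else (p a).natAbs := by
  rw [alternatingWord, List.map_flatten, List.sum_flatten, List.map_ofFn, List.map_ofFn,
    List.sum_ofFn]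
  refine Finset.sum_congr rfl fun a _ => ?_
  cases g <;> simp

/-! ### Letters that are cyclically adjacent -/

/-- Two letters with the same generator are equal and are not `v` or its inverse. -/
def Compatible (a b : Bool × Bool) : Prop := a.1 = b.1 → a.1 = false ∧ a.2 = b.2

lemma rel_finRotate_of_isChain {α : Type*} {r : α → α → Prop} {l : List α}
    (h : l.IsChain r) (hlast : ∀ x ∈ l.getLast?, ∀ y ∈ l.head?, r x y) (j : Fin l.length) :
    r (l.get j) (l.get (finRotate l.length j)) := by
  by_cases hj : (j : ℕ) + 1 < l.length
  · have hrot : finRotate l.length j = ⟨j + 1, hj⟩ := by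
      obtain ⟨n, hn⟩ : ∃ n, l.length = n + 1 := ⟨l.length - 1, by omega⟩
      generalize l.length = m at *
      subst hn
      exact finRotate_of_lt (by omega)
    rw [hrot]
    exact List.isChain_iff_getElem.mp h j hj
  · have hj' : (j : ℕ) = l.length - 1 := by omega
    have hrot : finRotate l.length j = ⟨0, j.pos⟩ := by
      obtain ⟨n, hn⟩ : ∃ n, l.length = n + 1 := ⟨l.length - 1, by omega⟩
      generalize l.length = m at *
      subst hn
      have : j = Fin.last n := Fin.ext (by simpa using hj')
      rw [this, finRotate_last]
      rfl
    rw [hrot]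
    refine hlast _ ?_ _ ?_
    · rw [List.getLast?_eq_getElem?]
      simp [← hj']
    · rw [List.head?_eq_getElem?]
      simp [j.pos]

section Alternating

variable {s : ℕ} {p ε : Fin s → ℤ}

/-- Each block is a nonempty run of one u-type letter followed by a single v-type letter. The
generator therefore changes inside a block before its last letter, between blocks, and at the cyclic
closure. -/
lemma isChain_alternatingWord (hp : ∀ a, p a ≠ 0) (hε : ∀ a, ε a = 1 ∨ ε a = -1) :
    (alternatingWord p ε).IsChain Compatible ∧
      ∀ x ∈ (alternatingWord p ε).getLast?, ∀ y ∈ (alternatingWord p ε).head?,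
        Compatible x y := by
  have hε1 : ∀ a, (ε a).natAbs = 1 := fun a => by rcases hε a with h | h <;> simp [h]
  have hlast : ∀ l ∈ List.ofFn fun a => List.replicate (p a).natAbs (false, decide (0 < p a)) ++
      List.replicate (ε a).natAbs (true, decide (0 < ε a)), ∀ x ∈ l.getLast?, x.1 = true := by
    intro l hl x hx
    obtain ⟨a, rfl⟩ := (List.mem_ofFn' _ _).mp hl
    simp only [hε1, List.replicate_one, List.getLast?_append, List.getLast?_singleton,
      Option.some_or, Option.mem_def, Option.some.injEq] at hx
    rw [← hx]
  have hhead : ∀ l ∈ List.ofFn fun a => List.replicate (p a).natAbs (false, decide (0 < p a)) ++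
      List.replicate (ε a).natAbs (true, decide (0 < ε a)), ∀ x ∈ l.head?, x.1 = false := by
    intro l hl x hx
    obtain ⟨a, rfl⟩ := (List.mem_ofFn' _ _).mp hl
    simp only [List.head?_append, List.head?_replicate, Int.natAbs_eq_zero, hp, if_false,
      Option.some_or, Option.mem_def, Option.some.injEq] at hx
    rw [← hx]
  refine ⟨?_, fun x hx y hy => ?_⟩
  · rw [alternatingWord, List.isChain_flatten]
    · refine ⟨fun l hl => ?_, ?_⟩
      · obtain ⟨a, rfl⟩ := (List.mem_ofFn' _ _).mp hl
        beta_reduce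
        rw [hε1, List.replicate_one, List.isChain_append]
        refine ⟨List.isChain_replicate_of_rel _ fun _ => ⟨rfl, rfl⟩, List.isChain_singleton _, ?_⟩
        intro x hx y hy
        have hx' := List.eq_of_mem_replicate (List.mem_of_mem_getLast? hx)
        simp only [List.head?_singleton, Option.mem_def, Option.some.injEq] at hy
        rw [hx', ← hy]
        intro h
        simp at h
      · refine List.Pairwise.isChain (List.pairwise_of_forall_mem_list ?_)
        intro l hl l' hl' x hx y hy h
        rw [hlast l hl x hx, hhead l' hl' y hy] at h
        simp at h
    · intro h
      obtain ⟨a, ha⟩ := (List.mem_ofFn' _ _).mp h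
      simp [hp] at ha
  · rw [alternatingWord, List.getLast?_flatten] at hx
    rw [alternatingWord, List.head?_flatten] at hy
    obtain ⟨l, hl, hlx⟩ := List.exists_of_findSome?_eq_some hx
    obtain ⟨l', hl', hly⟩ := List.exists_of_findSome?_eq_some hy
    intro h
    rw [hlast l (List.mem_reverse.mp hl) x hlx, hhead l' hl' y hly] at h
    simp at h

lemma alternatingWord_ne_nil (hs : 1 ≤ s) (hp : ∀ a, p a ≠ 0) : alternatingWord p ε ≠ [] := by
  rw [alternatingWord, Ne, List.flatten_eq_nil_iff]
  intro h
  have := h _ ((List.mem_ofFn' _ _).mpr ⟨⟨0, hs⟩, rfl⟩)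
  simp [hp] at this

end Alternating

/-! ### The shape of the involution -/

section Symbols

variable {t : ℕ} (w : Fin t → List (Bool × Bool))

/-- For x in w_k⁻¹, I x is the letter of w_k that follows the inverse of x, so adjacency in w_k
decides. For x in w_k, I x lies in w_k⁻¹ and I is an involution. -/
lemma letter_invI (h : ∀ k j, Compatible ((w k).get j) ((w k).get (finRotate _ j)))
    (x : Sym w) :
    (letter w x).1 = (letter w (invI w x)).1 →
      (letter w x).1 = false ∧ (letter w (invI w x)).2 = !(letter w x).2 := by
  have key : ∀ k j, (letter w ⟨k, true, j⟩).1 = (letter w (invI w ⟨k, true, j⟩)).1 →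
      (letter w ⟨k, true, j⟩).1 = false ∧
        (letter w (invI w ⟨k, true, j⟩)).2 = !(letter w ⟨k, true, j⟩).2 := by
    intro k j hj
    have := h k j.rev hj
    refine ⟨this.1, ?_⟩
    change ((w k).get (finRotate _ j.rev)).2 = !(!((w k).get j.rev).2)
    rw [← this.2, Bool.not_not]
  rcases x with ⟨k, _ | _, j⟩
  · intro hj
    have hinv := invI_involutive w ⟨k, false, j⟩
    have := key k (finRotate _ j.rev)
    change (letter w (invI w ⟨k, false, j⟩)).1 = (letter w (invI w (invI w ⟨k, false, j⟩))).1 →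
      (letter w (invI w ⟨k, false, j⟩)).1 = false ∧
        (letter w (invI w (invI w ⟨k, false, j⟩))).2 = !(letter w (invI w ⟨k, false, j⟩)).2
      at this
    rw [hinv] at this
    obtain ⟨h1, h2⟩ := this hj.symm
    exact ⟨hj.trans h1, by rw [h2, Bool.not_not]⟩
  · exact key k j

/-- The symbols with a given letter whose image under `I` has a given letter. -/
abbrev SymPair (l l' : Bool × Bool) : Type :=
  {x : Sym w // letter w x = l ∧ letter w (invI w x) = l'}

lemma val_eq_of_mk_eq {l : Bool × Bool} {x y : Sym w} {hx : letter w x = l} {hy : letter w y = l}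
    (h : (⟨x, hx⟩ : SymOf w l) = ⟨y, hy⟩) : x = y := congrArg Subtype.val h

lemma card_symPair_comm (l l' : Bool × Bool) :
    Fintype.card (SymPair w l l') = Fintype.card (SymPair w l' l) :=
  Fintype.card_congr ((invI w).subtypeEquiv fun x => by rw [invI_involutive w x, and_comm])

lemma card_symOf_eq_sum (l : Bool × Bool) :
    Fintype.card (SymOf w l) = ∑ l', Fintype.card (SymPair w l l') := by
  simp only [Fintype.card_subtype, ← Finset.filter_filter]
  exact Finset.card_eq_sum_card_fiberwise fun _ _ => Finset.mem_univ _

lemma card_symPair_eq_zero (h : ∀ x : Sym w, (letter w x).1 = (letter w (invI w x)).1 →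
      (letter w x).1 = false ∧ (letter w (invI w x)).2 = !(letter w x).2)
    {l l' : Bool × Bool} (hl : l.1 = l'.1) (hl' : l.1 = true ∨ l = l') :
    Fintype.card (SymPair w l l') = 0 := by
  rw [Fintype.card_eq_zero_iff]
  refine ⟨fun ⟨x, hx, hx'⟩ => ?_⟩
  have := h x
  rw [hx, hx'] at this
  obtain ⟨h1, h2⟩ := this hl
  rcases hl' with hl' | rfl
  · rw [hl'] at h1
    simp at h1
  · simp at h2

variable {n m : ℕ}

lemma exists_identifications (h : ∀ x : Sym w, (letter w x).1 = (letter w (invI w x)).1 →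
      (letter w x).1 = false ∧ (letter w (invI w x)).2 = !(letter w x).2)
    (hU : Fintype.card (SymU w) = n) (hU' : Fintype.card (SymUs w) = n)
    (hV : Fintype.card (SymV w) = m) (hV' : Fintype.card (SymVs w) = m) :
    ∃ (eU : SymU w ≃ XSet n m) (eU' : SymUs w ≃ XSet n m)
        (eV : SymV w ≃ Fin m) (eV' : SymVs w ≃ Fin m) (τ : Fin m → Bool),
      ∀ l : Labels n m, invI w (symbolOf eU eU' eV eV' l) =
          symbolOf eU eU' eV eV' (modelI τ l) := by
  have cU := hU.symm.trans (card_symOf_eq_sum w (false, true))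
  have cU' := hU'.symm.trans (card_symOf_eq_sum w (false, false))
  have cV := hV.symm.trans (card_symOf_eq_sum w (true, true))
  have cV' := hV'.symm.trans (card_symOf_eq_sum w (true, false))
  simp only [Fintype.sum_prod_type, Fintype.sum_bool] at cU cU' cV cV'
  have z1 := card_symPair_eq_zero w h (l := (false, true)) (l' := (false, true)) rfl (.inr rfl)
  have z2 := card_symPair_eq_zero w h (l := (false, false)) (l' := (false, false)) rfl (.inr rfl)
  have z3 := card_symPair_eq_zero w h (l := (true, true)) (l' := (true, true)) rfl (.inl rfl)
  have z4 := card_symPair_eq_zero w h (l := (true, true)) (l' := (true, false)) rfl (.inl rfl)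
  have z5 := card_symPair_eq_zero w h (l := (true, false)) (l' := (true, true)) rfl (.inl rfl)
  have z6 := card_symPair_eq_zero w h (l := (true, false)) (l' := (true, false)) rfl (.inl rfl)
  have s1 := card_symPair_comm w (false, true) (false, false)
  have s2 := card_symPair_comm w (false, true) (true, true)
  have s3 := card_symPair_comm w (false, true) (true, false)
  have s4 := card_symPair_comm w (false, false) (true, true)
  have s5 := card_symPair_comm w (false, false) (true, false)
  -- Let a, b count pairs U–V and U–V*, and d, e pairs U*–V* and U*–V. Counting V, V* and comparing
  -- U with U* gives a + e = m, b + d = m and a + b = d + e. Hence d = a, e = b, a + b = m, and n -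
  -- m pairs U–U* remain.
  obtain ⟨a, ha⟩ : ∃ a, Fintype.card (SymPair w (false, true) (true, true)) = a := ⟨_, rfl⟩
  obtain ⟨b, hb⟩ : ∃ b, Fintype.card (SymPair w (false, true) (true, false)) = b := ⟨_, rfl⟩
  have hA : Fintype.card (SymPair w (false, true) (false, false)) = n - m := by omega
  have hD : Fintype.card (SymPair w (false, false) (true, false)) = a := by omega
  have hE : Fintype.card (SymPair w (false, false) (true, true)) = b := by omega
  have hab : m = a + b := by omega
  have hnm : n - m + m = n := by omega
  set A := (Fintype.equivFinOfCardEq hA).symm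
  set B := (Fintype.equivFinOfCardEq ha).symm
  set C := (Fintype.equivFinOfCardEq hb).symm
  set D := (Fintype.equivFinOfCardEq hD).symm
  set E := (Fintype.equivFinOfCardEq hE).symm
  set q : Fin m ≃ Fin a ⊕ Fin b := (finCongr hab).trans finSumFinEquiv.symm
  have hI : ∀ {l l'} (x : SymPair w l l'), letter w (invI w x) = l' := fun x => x.2.2
  have hII : ∀ x, invI w (invI w x) = x := invI_involutive w
  -- The first a of the y-labels enumerate U–V and U*–V* pairs, the last b enumerate U–V* and U*–V
  -- pairs; all other labels are images under I. So τ is `isLeft` of the splitting `q`.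
  let fU : XSet n m → SymU w := Sum.elim (fun i => ⟨A i, (A i).2.1⟩)
    (fun i => Sum.elim (fun j => ⟨B j, (B j).2.1⟩) (fun j => ⟨C j, (C j).2.1⟩) (q i))
  let fU' : XSet n m → SymUs w := Sum.elim (fun i => ⟨invI w (A i), hI _⟩)
    (fun i => Sum.elim (fun j => ⟨D j, (D j).2.1⟩) (fun j => ⟨E j, (E j).2.1⟩) (q i))
  let fV : Fin m → SymV w := fun i => Sum.elim (fun j => ⟨invI w (B j), hI _⟩)
    (fun j => ⟨invI w (E j), hI _⟩) (q i)
  let fV' : Fin m → SymVs w := fun i => Sum.elim (fun j => ⟨invI w (D j), hI _⟩)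
    (fun j => ⟨invI w (C j), hI _⟩) (q i)
  -- The letters at x and I x determine the piece containing x, so distinct pieces are disjoint.
  have hcross : ∀ {l l' l₂ l₂'} (x : SymPair w l l') (y : SymPair w l₂ l₂'),
      (x : Sym w) = y → l = l₂ ∧ l' = l₂' := fun x y hxy =>
    ⟨by rw [← x.2.1, hxy, y.2.1], by rw [← x.2.2, hxy, y.2.2]⟩
  have bU : Function.Bijective fU := by
    rw [Fintype.bijective_iff_injective_and_card]
    refine ⟨?_, by simp [hU, hnm]⟩
    refine Function.Injective.sumElim ?_ ((Function.Injective.sumElim ?_ ?_ ?_).comp q.injective) ?_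
    · exact fun i j hij => A.injective (Subtype.ext (val_eq_of_mk_eq w hij))
    · exact fun i j hij => B.injective (Subtype.ext (val_eq_of_mk_eq w hij))
    · exact fun i j hij => C.injective (Subtype.ext (val_eq_of_mk_eq w hij))
    · exact fun i j hij => by simpa using hcross _ _ (val_eq_of_mk_eq w hij)
    · intro i j hij
      rcases hq : q j with j' | j' <;> rw [hq] at hij <;>
        simpa using hcross _ _ (val_eq_of_mk_eq w hij)
  have bU' : Function.Bijective fU' := by
    rw [Fintype.bijective_iff_injective_and_card]
    refine ⟨?_, by simp [hU', hnm]⟩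
    refine Function.Injective.sumElim ?_ ((Function.Injective.sumElim ?_ ?_ ?_).comp q.injective) ?_
    · exact fun i j hij => A.injective
        (Subtype.ext ((invI w).injective (val_eq_of_mk_eq w hij)))
    · exact fun i j hij => D.injective (Subtype.ext (val_eq_of_mk_eq w hij))
    · exact fun i j hij => E.injective (Subtype.ext (val_eq_of_mk_eq w hij))
    · exact fun i j hij => by simpa using hcross _ _ (val_eq_of_mk_eq w hij)
    · intro i j hij
      have hval := congrArg (fun x => invI w (Subtype.val x)) hij
      rcases hq : q j with j' | j' <;> simp only [hq, Sum.elim_inl, Sum.elim_inr, hII] at hval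
      · have := congrArg (letter w) hval
        rw [(A i).2.1, hI] at this
        simp at this
      · have := congrArg (letter w) hval
        rw [(A i).2.1, hI] at this
        simp at this
  have bV : Function.Bijective fV := by
    rw [Fintype.bijective_iff_injective_and_card]
    refine ⟨?_, by simp [hV]⟩
    refine (Function.Injective.sumElim ?_ ?_ ?_).comp q.injective
    · exact fun i j hij => B.injective
        (Subtype.ext ((invI w).injective (val_eq_of_mk_eq w hij)))
    · exact fun i j hij => E.injective
        (Subtype.ext ((invI w).injective (val_eq_of_mk_eq w hij)))
    · exact fun i j hij => by
        simpa using hcross _ _ ((invI w).injective (val_eq_of_mk_eq w hij))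
  have bV' : Function.Bijective fV' := by
    rw [Fintype.bijective_iff_injective_and_card]
    refine ⟨?_, by simp [hV']⟩
    refine (Function.Injective.sumElim ?_ ?_ ?_).comp q.injective
    · exact fun i j hij => D.injective
        (Subtype.ext ((invI w).injective (val_eq_of_mk_eq w hij)))
    · exact fun i j hij => C.injective
        (Subtype.ext ((invI w).injective (val_eq_of_mk_eq w hij)))
    · exact fun i j hij => by
        simpa using hcross _ _ ((invI w).injective (val_eq_of_mk_eq w hij))
  refine ⟨(Equiv.ofBijective fU bU).symm, (Equiv.ofBijective fU' bU').symm,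
    (Equiv.ofBijective fV bV).symm, (Equiv.ofBijective fV' bV').symm, fun i => (q i).isLeft, ?_⟩
  have hmodel : ∀ (τ : Fin m → Bool) (l : Labels n m), modelI τ l = modelFun τ l := fun _ _ => rfl
  rintro (((i | i) | (i | i)) | (i | i)) <;> rw [hmodel]
  · rfl
  · rcases hq : q i with j | j <;> simp [symbolOf, modelFun, hq, fU, fV, fV']
  · exact hII _
  · rcases hq : q i with j | j <;> simp [symbolOf, modelFun, hq, fU', fV, fV']
  · rcases hq : q i with j | j <;> simp [symbolOf, modelFun, hq, fU, fU', fV, hII]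
  · rcases hq : q i with j | j <;> simp [symbolOf, modelFun, hq, fU, fU', fV', hII]

end Symbols

/-! ### Relabelling `R` -/

lemma numCycles_eq_of_semiconj {α β : Type*} (e : α ≃ β) {π : Equiv.Perm α} {ρ : Equiv.Perm β}
    (h : ∀ a, e (π a) = ρ (e a)) : numCycles π = numCycles ρ := by
  have hρ : ρ = e.permCongrHom π := by
    ext b
    obtain ⟨a, rfl⟩ := e.surjective b
    simp [← h, Equiv.permCongrHom]
  refine Nat.card_congr (Quotient.congr e fun a b => exists_congr fun k => ?_)
  rw [hρ, ← map_zpow]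
  simp [Equiv.permCongrHom]

lemma relabel_perm {α β : Type*} (e : α ≃ β) (σ : Equiv.Perm α) :
    relabel e (perm σ) = perm (e.permCongr σ) := by
  simp [relabel, perm, MonoidAlgebra.domCongr_single, Equiv.permCongrHom]

section Relabel

variable {t : ℕ} {w : Fin t → List (Bool × Bool)} {n m : ℕ}
  (eU : SymU w ≃ XSet n m) (eU' : SymUs w ≃ XSet n m)
  (eV : SymV w ≃ Fin m) (eV' : SymVs w ≃ Fin m)

lemma symbolOf_bijective : Function.Bijective (symbolOf eU eU' eV eV') := by
  constructor
  · have hne : ∀ {l l' : Bool × Bool} (x : SymOf w l) (y : SymOf w l'),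
        (x : Sym w) = y → l = l' := fun x y hxy => by rw [← x.2, hxy, y.2]
    refine Function.Injective.sumElim (Function.Injective.sumElim ?_ ?_ ?_)
      (Function.Injective.sumElim ?_ ?_ ?_) ?_
    · exact Subtype.val_injective.comp eU.symm.injective
    · exact Subtype.val_injective.comp eU'.symm.injective
    · exact fun x y hxy => by simpa using hne _ _ hxy
    · exact Subtype.val_injective.comp eV.symm.injective
    · exact Subtype.val_injective.comp eV'.symm.injective
    · exact fun x y hxy => by simpa using hne _ _ hxy
    · rintro (x | x) (y | y) hxy <;> simpa using hne _ _ hxy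
  · refine (forall_by_letter w fun x => ∃ l, symbolOf eU eU' eV eV' l = x).mpr
      ⟨⟨fun x => ⟨.inl (.inl (eU x)), ?_⟩, fun x => ⟨.inl (.inr (eU' x)), ?_⟩⟩,
        fun x => ⟨.inr (.inl (eV x)), ?_⟩, fun x => ⟨.inr (.inr (eV' x)), ?_⟩⟩ <;>
      simp [symbolOf]

/-- The bijection `symbolOf` carries both I and the concatenated permutation to their models, so the
cycle counts agree term by term. -/
lemma relabelTensor_elementR {τ : Fin m → Bool}
    (h : ∀ l : Labels n m, invI w (symbolOf eU eU' eV eV' l) =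
      symbolOf eU eU' eV eV' (modelI τ l)) (N : ℕ) :
    relabelTensor eU eU' eV eV' (elementR w N) = modelR τ N := by
  simp only [elementR, modelR, map_sum, map_smul, relabelTensor, TensorProduct.congr_tmul,
    relabel_perm]
  rw [← eU.permCongr.sum_comp]
  refine Finset.sum_congr rfl fun σu _ => ?_
  rw [← eU'.permCongr.sum_comp]
  refine Finset.sum_congr rfl fun θu _ => ?_
  rw [← eV.permCongr.sum_comp]
  refine Finset.sum_congr rfl fun σv _ => ?_
  rw [← eV'.permCongr.sum_comp]
  refine Finset.sum_congr rfl fun θv _ => ?_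
  congr 2
  refine (numCycles_eq_of_semiconj
    (Equiv.ofBijective _ (symbolOf_bijective eU eU' eV eV')) fun l => ?_).symm
  obtain ⟨⟨h1, h2⟩, h3, h4⟩ := concat_apply w σu θu σv θv
  simp only [Equiv.ofBijective_apply, Equiv.Perm.mul_apply, ← h]
  congr 1
  rcases l with (x | x) | (x | x) <;> simp [symbolOf, h1, h2, h3, h4]

end Relabel

end TraceWords

end

/-! ### The proposition for the words U^{p₁} V^{ε₁} ⋯ U^{pₛ} V^{εₛ} -/

theorem mainTheorem5 (t : ℕ) (s : Fin t → ℕ) (hs : ∀ k, 1 ≤ s k)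
    (p ε : (k : Fin t) → Fin (s k) → ℤ)
    (hp : ∀ k a, 3 ≤ |p k a|) (hε : ∀ k a, ε k a = 1 ∨ ε k a = -1)
    (w : Fin t → List (Bool × Bool)) (hw : ∀ k, w k = TraceWords.alternatingWord (p k) (ε k))
    (n m : ℕ) (hn : n = Nat.card (TraceWords.SymU w)) (hm : m = Nat.card (TraceWords.SymV w)) :
    n = ∑ k, ∑ a, (p k a).natAbs ∧ m = ∑ k, s k ∧ m ≤ n ∧
    Function.Involutive (TraceWords.invI w) ∧
    (∃ (eU : TraceWords.SymU w ≃ TraceWords.XSet n m)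
        (eU' : TraceWords.SymUs w ≃ TraceWords.XSet n m)
        (eV : TraceWords.SymV w ≃ Fin m) (eV' : TraceWords.SymVs w ≃ Fin m)
        (τ : Fin m → Bool),
      (∀ l : TraceWords.Labels n m,
        TraceWords.invI w (TraceWords.symbolOf eU eU' eV eV' l) =
          TraceWords.symbolOf eU eU' eV eV' (TraceWords.modelI τ l)) ∧
      ∀ N : ℕ, TraceWords.relabelTensor eU eU' eV eV' (TraceWords.elementR w N) =
        TraceWords.modelR τ N) ∧
    ∀ N : ℕ, n < N →
      IsUnit (TraceWords.cycleElement (TraceWords.SymU w) N) ∧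
      IsUnit (TraceWords.cycleElement (TraceWords.SymV w) N) ∧
      ((∫ U, ∫ V, ∏ k, ‖Matrix.trace (TraceWords.evalWord (p k) (ε k) U V).1‖ ^ 2
          ∂TraceWords.haarU N ∂TraceWords.haarU N : ℝ) : ℂ) =
        TraceWords.functionalPhi w N (TraceWords.elementR w N) := by
  have hp0 : ∀ k a, p k a ≠ 0 := fun k a h => by
    have := hp k a
    simp [h] at this
  have hε1 : ∀ k a, (ε k a).natAbs = 1 := fun k a => by rcases hε k a with h | h <;> simp [h]
  have hcard : ∀ g b, Fintype.card (TraceWords.SymOf w (g, b)) =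
      ∑ k, ∑ a, if g then (ε k a).natAbs else (p k a).natAbs := fun g b => by
    rw [TraceWords.card_symOf]
    exact Finset.sum_congr rfl fun k _ => by rw [hw, TraceWords.sum_map_alternatingWord]
  have hn' : n = ∑ k, ∑ a, (p k a).natAbs := by
    rw [hn, Nat.card_eq_fintype_card, hcard]
    simp
  have hm' : m = ∑ k, s k := by
    rw [hm, Nat.card_eq_fintype_card, hcard]
    simp [hε1]
  have hmn : m ≤ n := by
    rw [hn', hm']
    refine Finset.sum_le_sum fun k _ => ?_
    calc s k = ∑ _a : Fin (s k), 1 := by simp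
      _ ≤ ∑ a, (p k a).natAbs := Finset.sum_le_sum fun a _ =>
        Nat.one_le_iff_ne_zero.mpr (Int.natAbs_ne_zero.mpr (hp0 k a))
  have hadj : ∀ k j, TraceWords.Compatible ((w k).get j) ((w k).get (finRotate _ j)) := by
    intro k
    rw [hw k]
    obtain ⟨h1, h2⟩ := TraceWords.isChain_alternatingWord (hp0 k) (hε k)
    exact TraceWords.rel_finRotate_of_isChain h1 h2
  have hne : ∀ k, w k ≠ [] := fun k =>
    hw k ▸ TraceWords.alternatingWord_ne_nil (hs k) (hp0 k)
  have hU : Fintype.card (TraceWords.SymU w) = n := by rw [hn, Nat.card_eq_fintype_card]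
  have hV : Fintype.card (TraceWords.SymV w) = m := by rw [hm, Nat.card_eq_fintype_card]
  have hU' : Fintype.card (TraceWords.SymUs w) = n := by rw [← hU, hcard, hcard]
  have hV' : Fintype.card (TraceWords.SymVs w) = m := by rw [← hV, hcard, hcard]
  obtain ⟨eU, eU', eV, eV', τ, hτ⟩ := TraceWords.exists_identifications w
    (TraceWords.letter_invI w hadj) hU hU' hV hV'
  refine ⟨hn', hm', hmn, TraceWords.invI_involutive w, ⟨eU, eU', eV, eV', τ, hτ,
    TraceWords.relabelTensor_elementR eU eU' eV eV' hτ⟩, fun N hN => ?_⟩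
  have hUN : Fintype.card (TraceWords.SymU w) ≤ N := hU.trans_le hN.le
  have hVN : Fintype.card (TraceWords.SymV w) ≤ N := hV.trans_le (hmn.trans hN.le)
  refine ⟨TraceWords.isUnit_cycleElement N hUN, TraceWords.isUnit_cycleElement N hVN, ?_⟩
  rw [TraceWords.functionalPhi_elementR w hUN hVN, ← TraceWords.integral_prod_norm_trace_sq w hne]
  simp only [TraceWords.evalWord_eq, hw]
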